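/- Notation. For a partition $\lambda$ let $(\mathbf a|\mathbf b)=(a_1,\dots,a_r|b_1,\dots,b_r)$ be its Frobenius indices (arm and leg lengths of the diagonal cells; $r$ is the Frobenius rank). For $k\ge 1$ and a $k$-tuple $L=(L_1,\dots,L_k)$ of integers $\ge -k$ let $\widetilde\pi_L=0$ if $L$ has repeated entries, and otherwise $\widetilde\pi_L=\mathrm{sgn}(L)\,\pi_\lambda$, where $\mathrm{sgn}(L)$ is the sign of the permutation sorting $L$ into increasing order $L'_1<\dots<L'_k$ and $\lambda_i=L'_{k-i+1}+i$ $(1\le i\le k)$. The infinite Grassmannian $\mathrm{Gr}_{\mathcal H_+}(\mathcal H)$ is the set of points $w=[\pi_\lambda(w)]_\lambda$ (nonzero families of complex numbers indexed by all partitions, up to a common nonzero factor; infinitely many may be nonzero) that satisfy all the Plücker relations $$\sum_{j=1}^{k+1}(-1)^j\,\widetilde\pi_{I_1,\dots,I_{k-1},J_j}\,\widetilde\pi_{J_1,\dots,\widehat{J_j},\dots,J_{k+1}}=0$$ for all $1\le k\le n$ and all tuples $I\in\{-k,\dots,n-k-1\}^{k-1}$, $J\in\{-k,\dots,n-k-1\}^{k+1}$.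 For $w\in\mathrm{Gr}_{\mathcal H_+}(\mathcal H)$, with a choice of homogeneous coordinates, let $\tau_w(\mathbf t)=\sum_\lambda\pi_\lambda(w)s_\lambda(\mathbf t)\in\mathbb C[[t_1,t_2,\dots]]$, where $s_\lambda(\mathbf t)=\det(h_{\lambda_i-i+j}(\mathbf t))$ is the Schur function, $\sum_{m\ge0}h_m(\mathbf t)z^m=\exp(\sum_{i\ge1}t_iz^i)$ and $h_m=0$ for $m<0$. Let $\mathbb F_{\mathbf x,\mathbf t}$ be the field of fractions of the ring $\mathbb C[[\mathbf x,\mathbf t]]$ of formal power series in the indeterminates $x_i$ $(i\in\mathbb Z)$ and $t_j$ $(j\ge1)$. Let $\mathbf A$ be the free abelian group of finitely supported $\mathbf n=(n_i)_{i\in\mathbb Z}$, $n_i\in\mathbb Z$, with basis $\boldsymbol\alpha_i$ $(i\in\mathbb Z)$. For $\mathbf n\in\mathbf A$ put $$H_w^{\mathbf n}=\prod_{i<j}(x_i-x_j)^{n_in_j}\;\tau_w\Big(\mathbf t+\sum_{i\in\mathbb Z}n_i[x_i]\Big)\in\mathbb F_{\mathbf x,\mathbf t},\qquad [x]=\Big(x,\frac{x^2}2,\frac{x^3}3,\dots\Big),$$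 and, for a partition $\lambda=(\mathbf a|\mathbf b)$ of Frobenius rank $r$, $H_w^{\mathbf n,\lambda}=H_w^{\mathbf n+\sum_{i=1}^r\boldsymbol\alpha_{a_i}-\sum_{i=1}^r\boldsymbol\alpha_{-b_i-1}}$. Proposition. Let $w\in\mathrm{Gr}_{\mathcal H_+}(\mathcal H)$ and $\mathbf n\in\mathbf A$. Then $H_w^{\mathbf n}\ne0$, and for every partition $\lambda=(\mathbf a|\mathbf b)$ of Frobenius rank $r$ the identity $$\frac{H_w^{\mathbf n,\lambda}}{H_w^{\mathbf n}}=\det\left(\frac{H_w^{\mathbf n+\boldsymbol\alpha_{a_i}-\boldsymbol\alpha_{-b_j-1}}}{H_w^{\mathbf n}}\right)_{1\le i,j\le r}$$ holds in $\mathbb F_{\mathbf x,\mathbf t}$, for every choice of homogeneous coordinates of $w$. -/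

import Mathlib

noncomputable section

/-! Partitions are Young diagrams: row `i` has length `μ.rowLen i` and column `j` has length
`μ.colLen j`, both indexed from `0`. -/

namespace KPGrassmannian

/-! ### Frobenius notation -/

/-- The Frobenius rank of a partition: the number of cells on the main diagonal. -/
def frobeniusRank (μ : YoungDiagram) : ℕ :=
  (μ.cells.filter fun c => c.1 = c.2).card

/-- The Frobenius index `aᵢ` (arm length of the `i`-th diagonal cell), for `i` below the rank. -/
def arm (μ : YoungDiagram) (i : ℕ) : ℕ := μ.rowLen i - (i + 1)

/-- The Frobenius index `bᵢ` (leg length of the `i`-th diagonal cell), for `i` below the rank. -/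
def leg (μ : YoungDiagram) (i : ℕ) : ℕ := μ.colLen i - (i + 1)

/-! ### The infinite Grassmannian -/

/-- The partition attached to a strictly increasing tuple `L₁ < ⋯ < L_k` of integers: its parts
are `L_{k-i+1} + i` for `i = 1, …, k` (they are nonnegative when `-k ≤ L₁`). -/
def partitionOfTuple {k : ℕ} (L : Fin k → ℤ) (hL : StrictMono L) : YoungDiagram :=
  YoungDiagram.ofRowLens (List.ofFn fun i : Fin k => (L i.rev + ((i : ℤ) + 1)).toNat) <| by
    apply Antitone.sortedGE_ofFn
    have key : ∀ (d : ℕ) (i j : Fin k), (j : ℕ) = i + d → L j.rev + d ≤ L i.rev := by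
      intro d
      induction d with
      | zero =>
        intro i j h
        have : i = j := Fin.ext (by omega)
        subst this
        simp
      | succ d ih =>
        intro i j h
        have hlt : (i : ℕ) + d < k := by omega
        have h1 := ih i ⟨i + d, hlt⟩ rfl
        have h2 : L j.rev < L (Fin.rev ⟨i + d, hlt⟩) := hL (by
          rw [Fin.rev_lt_rev]; exact Fin.lt_def.2 (by simp only; omega))
        push_cast
        omega
    intro i j hij
    have hij' : (i : ℕ) ≤ j := hij
    have h := key ((j : ℕ) - i) i j (by omega)
    apply Int.toNat_le_toNat
    push_cast [hij'] at h
    omega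

/-- The polynomial ring `ℂ[π_μ]` in indeterminates labelled by all partitions. -/
abbrev PluckerRing : Type := MvPolynomial YoungDiagram ℂ

/-- The Plücker coordinate labelled by an arbitrary tuple of indices, as an element of the
polynomial ring: `sgn(L) · π_μ` with `μ` the partition of the sorted tuple if the entries are
distinct, and `0` otherwise. -/
def pluckerCoord {k : ℕ} (L : Fin k → ℤ) : PluckerRing :=
  open Classical in
  if hL : Function.Injective L then
    ((Equiv.Perm.sign (Tuple.sort L) : ℤ) : PluckerRing) *
      MvPolynomial.X (partitionOfTuple (L ∘ Tuple.sort L)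
        ((Tuple.monotone_sort L).strictMono_of_injective
          (hL.comp (Tuple.sort L).injective)))
  else 0

/-- The Plücker quadratic form of a `(k-1)`-tuple `I` and a `(k+1)`-tuple `J`, `k = m + 1`. -/
def pluckerForm {m : ℕ} (I : Fin m → ℤ) (J : Fin (m + 2) → ℤ) : PluckerRing :=
  ∑ j : Fin (m + 2), (-1) ^ ((j : ℕ) + 1) *
    (pluckerCoord (Fin.snoc I (J j) : Fin (m + 1) → ℤ) *
      pluckerCoord (fun i : Fin (m + 1) => J (j.succAbove i)))

/-- The Plücker ideal of the infinite Grassmannian: it is generated by the Plücker forms of all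
the Grassmannians of `k`-planes in `n`-space (`k = m + 1 ≤ n`), whose indices run through
`-k, …, n - k - 1`. -/
def pluckerIdeal : Ideal PluckerRing :=
  Ideal.span {p | ∃ (m n : ℕ) (I : Fin m → ℤ) (J : Fin (m + 2) → ℤ), m + 1 ≤ n ∧
    (∀ i, -((m : ℤ) + 1) ≤ I i ∧ I i ≤ (n : ℤ) - (m + 1) - 1) ∧
    (∀ j, -((m : ℤ) + 1) ≤ J j ∧ J j ≤ (n : ℤ) - (m + 1) - 1) ∧ p = pluckerForm I J}

/-- The infinite Grassmannian: the points of the projective space with homogeneous coordinates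
labelled by partitions at which the whole Plücker ideal vanishes. No finiteness is imposed: all
the coordinates may be nonzero. -/
def Grassmannian : Set (Projectivization ℂ (YoungDiagram → ℂ)) :=
  {w | ∀ (v : YoungDiagram → ℂ) (hv : v ≠ 0), Projectivization.mk ℂ v hv = w →
    ∀ p ∈ pluckerIdeal, MvPolynomial.eval v p = 0}

/-! ### Schur functions and the tau function -/

/-- The series `ξ(t, z) = ∑_{i ≥ 1} tᵢ zⁱ` in `z`. -/
def xi : PowerSeries (MvPolynomial ℕ+ ℂ) :=
  PowerSeries.mk fun n => if hn : 0 < n then MvPolynomial.X ⟨n, hn⟩ else 0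

theorem hasSubst_xi : PowerSeries.HasSubst xi :=
  PowerSeries.HasSubst.of_constantCoeff_zero' (by simp [xi])

/-- The complete homogeneous symmetric functions in the flow variables (the normalized power sums
`tᵢ = pᵢ / i`): `hₙ` is the coefficient of `zⁿ` in `exp ξ(t, z)`, and `hₙ = 0` for `n < 0`. -/
def completeHom : ℤ → MvPolynomial ℕ+ ℂ
  | Int.ofNat n =>
      PowerSeries.coeff n ((PowerSeries.exp (MvPolynomial ℕ+ ℂ)).subst xi)
  | Int.negSucc _ => 0

/-- `hₙ` is homogeneous of weight `n`, where `tᵢ` has weight `i`. -/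
theorem completeHom_isWeightedHomogeneous (n : ℕ) :
    MvPolynomial.IsWeightedHomogeneous (fun i : ℕ+ => (i : ℕ)) (completeHom n) n := by
  have hpow : ∀ (k n : ℕ), MvPolynomial.IsWeightedHomogeneous (fun i : ℕ+ => (i : ℕ))
      (PowerSeries.coeff n (xi ^ k)) n := by
    intro k
    induction k with
    | zero =>
      intro n
      rw [pow_zero, PowerSeries.coeff_one]
      split_ifs with h
      · subst h
        exact MvPolynomial.isWeightedHomogeneous_one _ _
      · exact MvPolynomial.isWeightedHomogeneous_zero _ _ _
    | succ k ih =>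
      intro n
      rw [pow_succ, PowerSeries.coeff_mul]
      refine MvPolynomial.IsWeightedHomogeneous.sum _ _ _ fun p hp => ?_
      rw [← Finset.HasAntidiagonal.mem_antidiagonal.1 hp]
      refine (ih _).mul ?_
      rw [xi, PowerSeries.coeff_mk]
      split_ifs with h
      · exact MvPolynomial.isWeightedHomogeneous_X _ _ _
      · exact MvPolynomial.isWeightedHomogeneous_zero _ _ _
  change MvPolynomial.IsWeightedHomogeneous _ (PowerSeries.coeff n _) n
  rw [PowerSeries.coeff_subst' hasSubst_xi]
  refine finsum_induction (MvPolynomial.IsWeightedHomogeneous (fun i : ℕ+ => (i : ℕ)) · n)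
    (MvPolynomial.isWeightedHomogeneous_zero _ _ _) (fun _ _ h1 h2 => h1.add h2) fun d => ?_
  rw [PowerSeries.coeff_exp, smul_eq_mul, IsScalarTower.algebraMap_apply ℚ ℂ (MvPolynomial ℕ+ ℂ),
    MvPolynomial.algebraMap_eq]
  exact (hpow d n).C_mul _

/-- The Schur function `s_μ(t) = det (h_{μᵢ - i + j})`. -/
def schur (μ : YoungDiagram) : MvPolynomial ℕ+ ℂ :=
  Matrix.det (Matrix.of fun i j : Fin (μ.colLen 0) =>
    completeHom ((μ.rowLen i : ℤ) - (i : ℤ) + (j : ℤ)))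

/-- `s_μ` is homogeneous of weight `|μ|`, where `tᵢ` has weight `i`. -/
theorem schur_isWeightedHomogeneous (μ : YoungDiagram) :
    MvPolynomial.IsWeightedHomogeneous (fun i : ℕ+ => (i : ℕ)) (schur μ) μ.card := by
  have hcard : μ.card = ∑ i : Fin (μ.colLen 0), μ.rowLen i := by
    rw [Fin.sum_univ_eq_sum_range (fun i => μ.rowLen i) (μ.colLen 0)]
    change μ.cells.card = _
    rw [Finset.card_eq_sum_card_fiberwise (f := Prod.fst) (t := Finset.range (μ.colLen 0))]
    · refine Finset.sum_congr rfl fun i _ => ?_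
      rw [YoungDiagram.rowLen_eq_card]
      rfl
    · intro c hc
      have hc' : (c.1, c.2) ∈ μ := hc
      have h0 : (c.1, 0) ∈ μ := μ.up_left_mem le_rfl (Nat.zero_le _) hc'
      simpa using YoungDiagram.mem_iff_lt_colLen.1 h0
  rw [schur, Matrix.det_apply]
  refine MvPolynomial.IsWeightedHomogeneous.sum _ _ _ fun σ _ => ?_
  have hprod : MvPolynomial.IsWeightedHomogeneous (fun i : ℕ+ => (i : ℕ))
      (∏ i : Fin (μ.colLen 0), completeHom ((μ.rowLen (σ i) : ℤ) - ((σ i : ℕ) : ℤ) + ((i : ℕ) : ℤ)))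
      μ.card := by
    by_cases hneg : ∃ i : Fin (μ.colLen 0),
        (μ.rowLen (σ i) : ℤ) - ((σ i : ℕ) : ℤ) + ((i : ℕ) : ℤ) < 0
    · obtain ⟨i, hi⟩ := hneg
      obtain ⟨m, hm⟩ := Int.eq_negSucc_of_lt_zero hi
      rw [Finset.prod_eq_zero (Finset.mem_univ i) (by rw [hm]; rfl)]
      exact MvPolynomial.isWeightedHomogeneous_zero _ _ _
    · push Not at hneg
      have hsum : μ.card = ∑ i : Fin (μ.colLen 0),
          ((μ.rowLen (σ i) : ℤ) - ((σ i : ℕ) : ℤ) + ((i : ℕ) : ℤ)).toNat := by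
        zify
        rw [Finset.sum_congr rfl fun i _ => Int.toNat_of_nonneg (hneg i),
          Finset.sum_add_distrib, Finset.sum_sub_distrib,
          Equiv.sum_comp σ (fun i => (μ.rowLen i : ℤ)), Equiv.sum_comp σ (fun i => ((i : ℕ) : ℤ)),
          hcard]
        push_cast
        ring
      rw [hsum]
      refine MvPolynomial.IsWeightedHomogeneous.prod _ _ _ fun i _ => ?_
      have h := completeHom_isWeightedHomogeneous
        ((μ.rowLen (σ i) : ℤ) - ((σ i : ℕ) : ℤ) + ((i : ℕ) : ℤ)).toNat
      rwa [Int.toNat_of_nonneg (hneg i)] at h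
  rcases Int.units_eq_one_or (Equiv.Perm.sign σ) with h | h
  · rw [h, one_smul]
    exact hprod
  · rw [h, Units.neg_smul, one_smul]
    exact hprod.neg

/-- Only finitely many partitions contribute to each coefficient of the tau function. -/
theorem tau_support_finite (v : YoungDiagram → ℂ) (d : ℕ+ →₀ ℕ) :
    (Function.support fun μ : YoungDiagram => v μ * (schur μ).coeff d).Finite := by
  have hfin : {μ : YoungDiagram | μ.card = Finsupp.weight (fun i : ℕ+ => (i : ℕ)) d}.Finite := by
    set N := Finsupp.weight (fun i : ℕ+ => (i : ℕ)) d
    refine Set.Finite.of_finite_image (f := YoungDiagram.cells)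
      ((Finset.finite_toSet (Finset.range N ×ˢ Finset.range N).powerset).subset ?_)
      (fun μ _ ν _ h => YoungDiagram.ext h)
    rintro _ ⟨μ, hμ, rfl⟩
    rw [Finset.mem_coe, Finset.mem_powerset]
    intro c hc
    have hc' : (c.1, c.2) ∈ μ := hc
    have h1 := YoungDiagram.mem_iff_lt_rowLen.1 hc'
    have h2 := YoungDiagram.mem_iff_lt_colLen.1 hc'
    have h3 : (μ.row c.1).card ≤ N := (Finset.card_le_card (Finset.filter_subset _ _)).trans hμ.le
    have h4 : (μ.col c.2).card ≤ N := (Finset.card_le_card (Finset.filter_subset _ _)).trans hμ.le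
    rw [← YoungDiagram.rowLen_eq_card] at h3
    rw [← YoungDiagram.colLen_eq_card] at h4
    rw [Finset.mem_product, Finset.mem_range, Finset.mem_range]
    omega
  refine hfin.subset fun μ hμ => ?_
  by_contra h
  exact hμ (by simp only [(schur_isWeightedHomogeneous μ).coeff_eq_zero d (Ne.symm h), mul_zero])

/-- The tau function `τ(t) = ∑_μ π_μ s_μ(t)`, a formal power series in `t₁, t₂, …`, with the
infinite sum taken coefficientwise; each of these sums is finite, see `tau_support_finite`. -/
def tau (v : YoungDiagram → ℂ) : MvPowerSeries ℕ+ ℂ :=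
  fun d => ∑ᶠ μ : YoungDiagram, v μ * (schur μ).coeff d

/-! ### Lattice evaluations -/

/-- The ring `ℂ[[x, t]]` of formal power series in `xᵢ` (`i ∈ ℤ`) and `tⱼ` (`j ≥ 1`). -/
abbrev SeriesXT : Type := MvPowerSeries (ℤ ⊕ ℕ+) ℂ

/-- The fraction field of `ℂ[[x, t]]`. -/
abbrev FieldXT : Type := FractionRing SeriesXT

/-- The indeterminate `xᵢ`. -/
def x (i : ℤ) : SeriesXT := MvPowerSeries.X (Sum.inl i)

/-- The indeterminate `tⱼ`. -/
def t (j : ℕ+) : SeriesXT := MvPowerSeries.X (Sum.inr j)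

/-- The `j`-th component `tⱼ + ∑ᵢ nᵢ xᵢʲ / j` of `t + ∑ᵢ nᵢ [xᵢ]`. -/
def shiftedTime (n : ℤ →₀ ℤ) (j : ℕ+) : SeriesXT :=
  t j + ∑ i ∈ n.support, MvPowerSeries.C ((n i : ℂ) / ((j : ℕ) : ℂ)) * x i ^ (j : ℕ)

/-- Substituting the shifted times into a power series in `t₁, t₂, …` is legitimate. -/
theorem hasSubst_shiftedTime (n : ℤ →₀ ℤ) : MvPowerSeries.HasSubst (shiftedTime n) := by
  have ht : MvPowerSeries.HasSubst t :=
    { const_coeff := fun j => by simp [t]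
      coeff_zero := fun d => by
        refine Set.Subsingleton.finite fun j hj k hk => ?_
        simp only [t, Set.mem_ofPred_eq, MvPowerSeries.coeff_X, ne_eq, ite_eq_right_iff,
          one_ne_zero, imp_false, not_not] at hj hk
        exact Sum.inr_injective (Finsupp.single_left_injective one_ne_zero (hj.symm.trans hk)) }
  have hx : ∀ i : ℤ, MvPowerSeries.HasSubst fun j : ℕ+ => x i ^ (j : ℕ) := fun i =>
    { const_coeff := fun j => by simp [x]
      coeff_zero := fun d => by
        refine Set.Subsingleton.finite fun j hj k hk => ?_
        simp only [x, Set.mem_ofPred_eq, MvPowerSeries.coeff_X_pow, ne_eq, ite_eq_right_iff,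
          one_ne_zero, imp_false, not_not] at hj hk
        exact PNat.coe_injective (Finsupp.single_injective _ (hj.symm.trans hk)) }
  have hsum : shiftedTime n = t + ∑ i ∈ n.support,
      (fun j : ℕ+ => (MvPowerSeries.C ((n i : ℂ) / ((j : ℕ) : ℂ)) : SeriesXT)) *
        fun j : ℕ+ => x i ^ (j : ℕ) := by
    funext j
    simp [shiftedTime]
  rw [hsum]
  exact ht.add (Ideal.sum_mem (MvPowerSeries.hasSubstIdeal (σ := ℕ+) (τ := ℤ ⊕ ℕ+) (S := ℂ))
    fun i _ => (hx i).mul_left _)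

/-- `H^n = ∏_{i < j} (xᵢ - xⱼ)^{nᵢ nⱼ} · τ(t + ∑ᵢ nᵢ [xᵢ])` for a finitely supported `n`, where
`τ` is the tau function of the homogeneous coordinates `v`. -/
def H (v : YoungDiagram → ℂ) (n : ℤ →₀ ℤ) : FieldXT :=
  (∏ i ∈ n.support, ∏ j ∈ n.support with i < j,
      (algebraMap SeriesXT FieldXT (x i - x j)) ^ (n i * n j)) *
    algebraMap SeriesXT FieldXT (MvPowerSeries.subst (shiftedTime n) (tau v))

/-- The lattice basis vector `αᵢ`. -/
def α (i : ℤ) : ℤ →₀ ℤ := Finsupp.single i 1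

/-- `H^{n,μ} = H^{n + ∑ᵢ α_{aᵢ} - ∑ᵢ α_{-bᵢ-1}}` for a partition `μ = (a | b)`. -/
def HPart (v : YoungDiagram → ℂ) (n : ℤ →₀ ℤ) (μ : YoungDiagram) : FieldXT :=
  H v (n + ∑ i : Fin (frobeniusRank μ), α (arm μ i) -
    ∑ i : Fin (frobeniusRank μ), α (-(leg μ i : ℤ) - 1))

end KPGrassmannian

end

/-! The ratio formula is a formal consequence of the exchange form of the Plücker relations. By
`div_eq_det_of_exchange`, a function of tuples that alternates along a base tuple c and satisfies
exchange against c is, once divided by its nonzero value at c, the determinant of its values at the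
tuples obtained from c by replacing one entry. This is applied to y ↦ H at T + ∑ α_{yᵢ}, with a sign
making it alternate (`altH`), for T = n - ∑ α_{-bᵢ-1}, c = (-bᵢ-1) and d = (aᵢ).

The exchange relation for H comes from a determinant. The same formal lemma shows that the Plücker
coordinates of w at k-tuples in a window of 2k integers, unless all zero, are proportional to the
maximal minors of a 2k × k matrix (`IsPlucker.eq_det`). By Cauchy–Binet, τ cut down to the
partitions in the k × k box is then a single determinant (`IsPlucker.truncTau_eq_det`), whose rows
inherit the relation h_m(s) = h_m(s + [y]) - y h_{m-1}(s + [y]). Row operations (`det_mixedMatrix`)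
turn the Vandermonde product of the y's times τ(T + ∑ [yᵢ]) into a determinant in which yⱼ enters
row j only, and Cramer's rule gives exchange for such determinants. The relation passes to τ itself
modulo terms of ever higher weight (`IsPlucker.tauAt_exchange`).

The prefactor of H is this Vandermonde product up to sign, times a constant and factors depending on
a single yᵢ; the latter have the same total product in every term of the exchange
(`IsPlucker.altH_exchange`). The signs left at the end belong to columns and cancel. Nonvanishing of
H reduces, by setting all xᵢ = 0, to linear independence of Schur functions. -/

namespace KPGrassmannian

/-! ### Exchange relations and determinants -/

section Exchange

/-- Cramer's rule expresses det B times row i of A through the rows of B; substituting this into row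
i of A gives the identity. -/
theorem _root_.Matrix.det_mul_det_exchange {ι R : Type*} [Fintype ι] [DecidableEq ι] [CommRing R]
    (A B : Matrix ι ι R) (i : ι) :
    A.det * B.det = ∑ j, (A.updateRow i (B j)).det * (B.updateRow j (A i)).det := by
  have h := congr_arg (fun w => (A.updateRow i w).det) (Matrix.mulVec_cramer B.transpose (A i))
  have h2 : B.transpose.mulVec (B.transpose.cramer (A i)) =
      ∑ j, (B.updateRow j (A i)).det • B j := by
    ext l
    simp only [Matrix.mulVec, dotProduct, Matrix.transpose_apply, Finset.sum_apply, Pi.smul_apply,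
      smul_eq_mul, Matrix.cramer_transpose_apply]
    exact Finset.sum_congr rfl fun _ _ => mul_comm _ _
  simp only [h2, Matrix.det_updateRow_smul, Matrix.det_transpose, Matrix.updateRow_eq_self] at h
  rw [mul_comm, ← h]
  have h3 : ∀ s : Finset ι, (A.updateRow i (∑ j ∈ s, (B.updateRow j (A i)).det • B j)).det =
      ∑ j ∈ s, (A.updateRow i (B j)).det * (B.updateRow j (A i)).det := by
    intro s
    induction s using Finset.induction_on with
    | empty => simpa using Matrix.det_eq_zero_of_row_eq_zero i (by simp)
    | insert a s ha ih =>
      rw [Finset.sum_insert ha, Finset.sum_insert ha, Matrix.det_updateRow_add, ih,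
        Matrix.det_updateRow_smul, mul_comm]
  exact h3 Finset.univ

theorem _root_.Matrix.det_eq_sum_updateRow_single {ι R : Type*} [Fintype ι] [DecidableEq ι]
    [CommRing R] (A : Matrix ι ι R) (i : ι) :
    A.det = ∑ j, A i j * (A.updateRow i (Pi.single j 1)).det := by
  have := Matrix.det_mul_det_exchange A 1 i
  rw [Matrix.det_one, mul_one] at this
  rw [this]
  refine Finset.sum_congr rfl fun j _ => ?_
  rw [mul_comm]
  congr 1
  · rw [← Matrix.cramer_transpose_apply, Matrix.transpose_one, Matrix.cramer_one]
    rfl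
  · congr 2
    ext l
    rw [Matrix.one_apply, Pi.single_apply]
    simp only [eq_comm]

/-- Both sides satisfy the same expansion in the i-th entry (exchange on the left, Laplace on the
right), which replaces d i by entries of c. Induction on the set of positions whose entry is not yet
taken from c reduces to d = c ∘ f, where f is a permutation or both sides vanish. -/
theorem div_eq_det_of_exchange {ι X K : Type*} [Fintype ι] [DecidableEq ι] [Field K]
    (F : (ι → X) → K) (c : ι → X) (hc : F c ≠ 0)
    (hperm : ∀ σ : Equiv.Perm ι, F (c ∘ σ) = ((Equiv.Perm.sign σ : ℤ) : K) * F c)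
    (hninj : ∀ f : ι → ι, ¬ Function.Injective f → F (c ∘ f) = 0)
    (hex : ∀ (d : ι → X) (i : ι),
      F d * F c = ∑ j, F (Function.update c j (d i)) * F (Function.update d i (c j)))
    (d : ι → X) :
    F d / F c = Matrix.det (Matrix.of fun i j => F (Function.update c j (d i)) / F c) := by
  set M : (ι → X) → Matrix ι ι K := fun d =>
    Matrix.of fun i j => F (Function.update c j (d i)) / F c with hM
  change F d / F c = (M d).det
  -- Replacing the entry j of c by its entry l repeats an entry unless j = l, so at the entries of c
  -- the rows of `M` are unit vectors.
  have hMc : ∀ l j, F (Function.update c j (c l)) / F c = (Pi.single l 1 : ι → K) j := by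
    intro l j
    have hu : Function.update c j (c l) = c ∘ Function.update id j l := by
      rw [Function.comp_update]; rfl
    by_cases h : j = l
    · subst h
      simp [hc]
    · rw [hu, hninj _ (fun hinj => h ?_)]
      · simp [h]
      · apply hinj
        rw [Function.update_self, Function.update_of_ne (Ne.symm h)]
        rfl
  have hMu : ∀ d i j, M (Function.update d i (c j)) = (M d).updateRow i (Pi.single j 1) := by
    intro d i j
    ext a b
    by_cases h : a = i
    · subst h
      simp [hM, hMc]
    · simp [hM, h]
  have hrec : ∀ d i, F d / F c - (M d).det =
      ∑ j, M d i j * (F (Function.update d i (c j)) / F c - (M (Function.update d i (c j))).det) := by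
    intro d i
    have h1 : F d / F c = ∑ j, M d i j * (F (Function.update d i (c j)) / F c) := by
      rw [div_eq_iff hc, Finset.sum_mul, ← mul_left_inj' hc, hex d i, Finset.sum_mul]
      refine Finset.sum_congr rfl fun j _ => ?_
      simp only [hM, Matrix.of_apply]
      field_simp
    conv_lhs => rw [h1, Matrix.det_eq_sum_updateRow_single (M d) i]
    simp only [mul_sub, Finset.sum_sub_distrib, hMu]
  have hbase : ∀ f : ι → ι, F (c ∘ f) / F c - (M (c ∘ f)).det = 0 := by
    intro f
    have hMf : M (c ∘ f) = Matrix.of fun i => Pi.single (f i) (1 : K) := by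
      ext a b
      simp only [hM, Matrix.of_apply, Function.comp_apply, hMc]
    rw [hMf]
    by_cases hf : Function.Injective f
    · obtain ⟨σ, rfl⟩ : ∃ σ : Equiv.Perm ι, ⇑σ = f :=
        ⟨Equiv.ofBijective f (Finite.injective_iff_bijective.1 hf), rfl⟩
      have h1 : (Matrix.of fun i => Pi.single (σ i) (1 : K)) =
          (1 : Matrix ι ι K).submatrix σ id := by
        ext a b
        simp [Matrix.one_apply, Pi.single_apply, eq_comm]
      rw [hperm, h1, Matrix.det_permute, Matrix.det_one, mul_one, mul_div_assoc, div_self hc,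
        mul_one, sub_self]
    · rw [hninj f hf]
      rw [Function.Injective] at hf
      push Not at hf
      obtain ⟨a, b, hab, hne⟩ := hf
      rw [Matrix.det_zero_of_row_eq hne
        (congr_arg (fun l => (Pi.single l 1 : ι → K)) hab)]
      simp
  have key : ∀ (s : Finset ι) (d : ι → X), (∀ i ∉ s, d i ∈ Set.range c) →
      F d / F c - (M d).det = 0 := by
    intro s
    induction s using Finset.induction_on with
    | empty =>
      intro d hd
      choose f hf using fun i => hd i (Finset.notMem_empty i)
      rw [show d = c ∘ f from funext fun i => (hf i).symm]
      exact hbase f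
    | insert a s _ ih =>
      intro d hd
      rw [hrec d a]
      refine Finset.sum_eq_zero fun j _ => ?_
      rw [ih, mul_zero]
      intro i hi
      by_cases h : i = a
      · subst h
        simp
      · rw [Function.update_of_ne h]
        exact hd i (by simp [h, hi])
  exact sub_eq_zero.1 (key Finset.univ d fun i hi => absurd (Finset.mem_univ i) hi)

end Exchange

/-! ### Plücker coordinates of integer tuples -/

theorem partitionOfTuple_congr {k : ℕ} {L L' : Fin k → ℤ} (h : L = L') (hL : StrictMono L)
    (hL' : StrictMono L') : partitionOfTuple L hL = partitionOfTuple L' hL' := by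
  subst h; rfl

theorem pluckerCoord_of_not_injective {k : ℕ} {L : Fin k → ℤ} (hL : ¬ Function.Injective L) :
    pluckerCoord L = 0 := by
  rw [pluckerCoord, dif_neg hL]

theorem pluckerCoord_of_strictMono {k : ℕ} {L : Fin k → ℤ} (hL : StrictMono L) :
    pluckerCoord L = MvPolynomial.X (partitionOfTuple L hL) := by
  have h1 : Tuple.sort L = Equiv.refl _ := Tuple.sort_eq_refl_iff_monotone.2 hL.monotone
  rw [pluckerCoord, dif_pos hL.injective]
  rw [partitionOfTuple_congr (L' := L) (by rw [h1]; rfl) _ hL, h1]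
  simp

theorem pluckerCoord_comp_perm {k : ℕ} (L : Fin k → ℤ) (σ : Equiv.Perm (Fin k)) :
    pluckerCoord (L ∘ σ) = ((Equiv.Perm.sign σ : ℤ) : PluckerRing) * pluckerCoord L := by
  by_cases hL : Function.Injective L
  · have hLσ : Function.Injective (L ∘ σ) := hL.comp σ.injective
    have h1 := Tuple.comp_perm_comp_sort_eq_comp_sort (f := L) (σ := σ)
    have h2 : Tuple.sort L = σ * Tuple.sort (L ∘ σ) := by
      ext i
      have := congr_fun h1 i
      exact congr_arg _ (hL this).symm
    have h3 : Equiv.Perm.sign (Tuple.sort (L ∘ σ)) =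
        Equiv.Perm.sign σ * Equiv.Perm.sign (Tuple.sort L) := by
      rw [h2, map_mul, ← mul_assoc, Int.units_mul_self, one_mul]
    rw [pluckerCoord, dif_pos hLσ, pluckerCoord, dif_pos hL, partitionOfTuple_congr h1 _
      ((Tuple.monotone_sort L).strictMono_of_injective (hL.comp (Tuple.sort L).injective)), h3]
    push_cast
    ring
  · rw [pluckerCoord_of_not_injective hL, mul_zero, pluckerCoord_of_not_injective]
    intro h
    apply hL
    have := h.comp σ.symm.injective
    rwa [Function.comp_assoc, Equiv.self_comp_symm, Function.comp_id] at this

/-- The value of the Plücker coordinate labelled by a tuple of integers. -/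
noncomputable def pluckerValue (v : YoungDiagram → ℂ) {k : ℕ} (L : Fin k → ℤ) : ℂ :=
  MvPolynomial.eval v (pluckerCoord L)

theorem pluckerValue_of_not_injective (v : YoungDiagram → ℂ) {k : ℕ} {L : Fin k → ℤ}
    (hL : ¬ Function.Injective L) : pluckerValue v L = 0 := by
  rw [pluckerValue, pluckerCoord_of_not_injective hL, map_zero]

theorem pluckerValue_of_strictMono (v : YoungDiagram → ℂ) {k : ℕ} {L : Fin k → ℤ}
    (hL : StrictMono L) : pluckerValue v L = v (partitionOfTuple L hL) := by
  rw [pluckerValue, pluckerCoord_of_strictMono hL, MvPolynomial.eval_X]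

theorem pluckerValue_comp_perm (v : YoungDiagram → ℂ) {k : ℕ} (L : Fin k → ℤ)
    (σ : Equiv.Perm (Fin k)) :
    pluckerValue v (L ∘ σ) = ((Equiv.Perm.sign σ : ℤ) : ℂ) * pluckerValue v L := by
  rw [pluckerValue, pluckerCoord_comp_perm, map_mul, map_intCast, pluckerValue]

theorem cons_succAbove_cycleRange {X : Type*} {m : ℕ} (x : X) (c : Fin (m + 1) → X)
    (l : Fin (m + 1)) :
    (fun i => (Fin.cons x c : Fin (m + 2) → X) (l.succ.succAbove i)) ∘ Fin.cycleRange l =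
      Function.update c l x := by
  funext j
  simp only [Function.comp_apply, Fin.succAbove_cycleRange]
  by_cases h : j = l
  · subst h
    simp
  · rw [Equiv.swap_apply_of_ne_of_ne (Fin.succ_ne_zero j) (by simpa using h)]
    simp [h]

/-- All Plücker relations hold at the coordinates `v`. -/
def IsPlucker (v : YoungDiagram → ℂ) : Prop := ∀ p ∈ pluckerIdeal, MvPolynomial.eval v p = 0

theorem IsPlucker.exchange_last {v : YoungDiagram → ℂ} (hv : IsPlucker v) {m n : ℕ}
    (hmn : m + 1 ≤ n) (c d : Fin (m + 1) → ℤ)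
    (hc : ∀ i, -((m : ℤ) + 1) ≤ c i ∧ c i ≤ (n : ℤ) - (m + 1) - 1)
    (hd : ∀ i, -((m : ℤ) + 1) ≤ d i ∧ d i ≤ (n : ℤ) - (m + 1) - 1) :
    pluckerValue v d * pluckerValue v c =
      ∑ j, pluckerValue v (Function.update c j (d (Fin.last m))) *
        pluckerValue v (Function.update d (Fin.last m) (c j)) := by
  -- With I = d without its last entry and J = (last entry of d, c), the term j = 0 is minus the
  -- left-hand side.
  have h := hv (pluckerForm (Fin.init d) (Fin.cons (d (Fin.last m)) c)) <| Ideal.subset_span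
    ⟨m, n, _, _, hmn, fun i => hd _, fun j => by
      refine Fin.cases ?_ (fun j => ?_) j
      · simpa using hd _
      · simpa using hc _, rfl⟩
  rw [pluckerForm, map_sum, Fin.sum_univ_succ] at h
  simp only [map_mul, map_pow, map_neg, map_one, Fin.val_zero, zero_add, pow_one, Fin.cons_zero,
    Fin.snoc_init_self, Fin.succAbove_zero, Fin.cons_succ, Fin.val_succ, neg_mul, one_mul] at h
  rw [neg_add_eq_zero] at h
  refine h.trans (Finset.sum_congr rfl fun j _ => ?_)
  rw [← cons_succAbove_cycleRange, pluckerValue_comp_perm, Fin.sign_cycleRange]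
  have h1 : (Fin.snoc (Fin.init d) (c j) : Fin (m + 1) → ℤ) =
      Function.update d (Fin.last m) (c j) := by
    conv_rhs => rw [← Fin.snoc_init_self d, Fin.update_snoc_last]
  rw [h1, pluckerValue, pluckerValue]
  push_cast
  ring

theorem IsPlucker.exchange {v : YoungDiagram → ℂ} (hv : IsPlucker v) {k n : ℕ}
    (hkn : k ≤ n) (c d : Fin k → ℤ)
    (hc : ∀ i, -(k : ℤ) ≤ c i ∧ c i ≤ (n : ℤ) - k - 1)
    (hd : ∀ i, -(k : ℤ) ≤ d i ∧ d i ≤ (n : ℤ) - k - 1) (i : Fin k) :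
    pluckerValue v d * pluckerValue v c =
      ∑ j, pluckerValue v (Function.update c j (d i)) *
        pluckerValue v (Function.update d i (c j)) := by
  obtain ⟨m, rfl⟩ : ∃ m, k = m + 1 := ⟨k - 1, by have := i.2; omega⟩
  push_cast at hc hd
  set σ := Equiv.swap i (Fin.last m)
  have h := hv.exchange_last hkn c (d ∘ σ) hc (fun i => hd _)
  have h1 : ∀ x, Function.update (d ∘ σ) (Fin.last m) x = Function.update d i x ∘ σ := by
    intro x
    rw [Function.update_comp_equiv]
    simp [σ]
  have hs : ((Equiv.Perm.sign σ : ℤ) : ℂ) ≠ 0 := by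
    rcases Int.units_eq_one_or (Equiv.Perm.sign σ) with h | h <;> simp [h]
  simp only [h1, pluckerValue_comp_perm] at h
  simp only [Function.comp_apply, σ, Equiv.swap_apply_right] at h
  apply mul_left_cancel₀ hs
  rw [← mul_assoc, h, Finset.mul_sum]
  exact Finset.sum_congr rfl fun j _ => by ring

/-- This recovers a k-plane from its Plücker coordinates: normalized at c, the entry (x, j) of its
matrix is the coordinate with cⱼ replaced by x. -/
theorem IsPlucker.eq_det {v : YoungDiagram → ℂ} (hv : IsPlucker v) {k n : ℕ} (hkn : k ≤ n)
    (c : Fin k → Fin n) (hc : pluckerValue v (fun i => ((c i : ℕ) : ℤ) - k) ≠ 0) :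
    ∃ W : Matrix (Fin n) (Fin k) ℂ, ∀ L : Fin k → Fin n,
      pluckerValue v (fun i => ((L i : ℕ) : ℤ) - k) =
        pluckerValue v (fun i => ((c i : ℕ) : ℤ) - k) * (W.submatrix L id).det := by
  set F : (Fin k → Fin n) → ℂ := fun L => pluckerValue v (fun i => ((L i : ℕ) : ℤ) - k) with hF
  refine ⟨Matrix.of fun x j => F (Function.update c j x) / F c, fun L => ?_⟩
  have hb : ∀ (L : Fin k → Fin n) i,
      -(k : ℤ) ≤ ((L i : ℕ) : ℤ) - k ∧ ((L i : ℕ) : ℤ) - k ≤ (n : ℤ) - k - 1 := by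
    intro L i
    have := (L i).2
    omega
  have hup : ∀ (L : Fin k → Fin n) i x, (fun j => (((Function.update L i x) j : ℕ) : ℤ) - k) =
      Function.update (fun j => ((L j : ℕ) : ℤ) - k) i (((x : ℕ) : ℤ) - k) := by
    intro L i x
    funext j
    by_cases h : j = i
    · subst h; simp
    · simp [h]
  have hex : ∀ (d : Fin k → Fin n) (i : Fin k), F d * F c =
      ∑ j, F (Function.update c j (d i)) * F (Function.update d i (c j)) := by
    intro d i
    simp only [hF, hup]
    exact hv.exchange hkn _ _ (hb c) (hb d) i
  have hperm : ∀ σ : Equiv.Perm (Fin k), F (c ∘ σ) = ((Equiv.Perm.sign σ : ℤ) : ℂ) * F c :=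
    fun σ => pluckerValue_comp_perm v (fun i => ((c i : ℕ) : ℤ) - k) σ
  have hninj : ∀ f : Fin k → Fin k, ¬ Function.Injective f → F (c ∘ f) = 0 := fun f hf =>
    pluckerValue_of_not_injective v fun h => hf fun a b hab => h (by simp [hab])
  have := div_eq_det_of_exchange F c hc hperm hninj hex L
  rw [div_eq_iff hc, mul_comm] at this
  exact this


/-! ### Complete symmetric functions under the shift by [y] -/

section CompleteSymmetric

variable {R : Type*} [CommRing R] [Algebra ℂ R]

/-- Uniqueness for a linear differential equation: the coefficients are determined recursively, as
positive integers are invertible in a ℂ-algebra. -/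
theorem eq_of_derivative_eq_mul {f g a : PowerSeries R}
    (hf : PowerSeries.derivative R f = f * a) (hg : PowerSeries.derivative R g = g * a)
    (h0 : PowerSeries.coeff 0 f = PowerSeries.coeff 0 g) : f = g := by
  ext n
  induction n using Nat.strong_induction_on with
  | _ n ih =>
    rcases n with _ | n
    · exact h0
    · have h1 := congr_arg (PowerSeries.coeff n) hf
      have h2 := congr_arg (PowerSeries.coeff n) hg
      rw [PowerSeries.coeff_derivative, PowerSeries.coeff_mul] at h1 h2
      have h3 : PowerSeries.coeff (n + 1) f * ((n : R) + 1) =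
          PowerSeries.coeff (n + 1) g * ((n : R) + 1) := by
        rw [h1, h2]
        refine Finset.sum_congr rfl fun p hp => ?_
        rw [ih p.1 (by have := Finset.HasAntidiagonal.mem_antidiagonal.1 hp; omega)]
      have hu : IsUnit ((n : R) + 1) := by
        have : ((n : R) + 1) = algebraMap ℂ R ((n : ℂ) + 1) := by simp
        rw [this]
        exact (IsUnit.mk0 _ (by exact_mod_cast Nat.succ_ne_zero n)).map _
      exact hu.mul_right_cancel h3

/-- The complete homogeneous symmetric functions at the times `s`. -/
noncomputable def hAt (s : ℕ+ → R) (m : ℤ) : R := MvPolynomial.aeval s (completeHom m)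

/-- The generating series of the complete homogeneous symmetric functions at the times `s`. -/
noncomputable def hSeries (s : ℕ+ → R) : PowerSeries R :=
  PowerSeries.mk fun n => hAt s n

/-- The logarithmic derivative of `hSeries s`. -/
noncomputable def timeSeries (s : ℕ+ → R) : PowerSeries R :=
  PowerSeries.mk fun n => ((n : R) + 1) * s n.succPNat

theorem hAt_of_neg (s : ℕ+ → R) {m : ℤ} (hm : m < 0) : hAt s m = 0 := by
  obtain ⟨n, rfl⟩ := Int.eq_negSucc_of_lt_zero hm
  exact map_zero _

theorem hSeries_eq_map (s : ℕ+ → R) : hSeries s =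
    PowerSeries.map (MvPolynomial.aeval s : MvPolynomial ℕ+ ℂ →ₐ[ℂ] R).toRingHom
      ((PowerSeries.exp (MvPolynomial ℕ+ ℂ)).subst xi) := by
  ext n
  rw [PowerSeries.coeff_map, hSeries, PowerSeries.coeff_mk]
  rfl

theorem derivative_hSeries (s : ℕ+ → R) :
    PowerSeries.derivative R (hSeries s) = hSeries s * timeSeries s := by
  have h1 : PowerSeries.derivative _ ((PowerSeries.exp (MvPolynomial ℕ+ ℂ)).subst xi) =
      (PowerSeries.exp (MvPolynomial ℕ+ ℂ)).subst xi * PowerSeries.derivative _ xi := by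
    rw [PowerSeries.derivative_subst hasSubst_xi, PowerSeries.derivative_exp]
  have h2 := congr_arg
    (PowerSeries.map (MvPolynomial.aeval s : MvPolynomial ℕ+ ℂ →ₐ[ℂ] R).toRingHom) h1
  rw [map_mul, ← hSeries_eq_map] at h2
  have h3 : PowerSeries.map (MvPolynomial.aeval s : MvPolynomial ℕ+ ℂ →ₐ[ℂ] R).toRingHom
      (PowerSeries.derivative _ xi) = timeSeries s := by
    ext n
    rw [PowerSeries.coeff_map, PowerSeries.coeff_derivative, xi, timeSeries, PowerSeries.coeff_mk,
      PowerSeries.coeff_mk, dif_pos n.succ_pos, mul_comm]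
    have h4 : MvPolynomial.aeval s (MvPolynomial.X n.succPNat : MvPolynomial ℕ+ ℂ) =
        s n.succPNat := MvPolynomial.aeval_X _ _
    rw [← h4]
    simp only [AlgHom.toRingHom_eq_coe, RingHom.coe_coe, map_mul, map_add, map_natCast, map_one]
    rfl
  rw [h3] at h2
  rw [← h2]
  ext n
  simp [hSeries_eq_map, PowerSeries.coeff_derivative]

theorem coeff_zero_hSeries (s : ℕ+ → R) : PowerSeries.coeff 0 (hSeries s) = 1 := by
  have h1 : PowerSeries.constantCoeff
      ((PowerSeries.exp (MvPolynomial ℕ+ ℂ) - 1).subst xi) = 0 :=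
    PowerSeries.constantCoeff_subst_eq_zero
      (show PowerSeries.constantCoeff xi = 0 by simp [xi]) _ (by simp)
  rw [PowerSeries.subst_sub hasSubst_xi, map_sub, sub_eq_zero] at h1
  rw [hSeries_eq_map, PowerSeries.coeff_map, PowerSeries.coeff_zero_eq_constantCoeff_apply, h1,
    ← PowerSeries.coe_substAlgHom hasSubst_xi, map_one, map_one, map_one]

/-- The times `[y] = (y, y² / 2, y³ / 3, …)`. -/
noncomputable def bracket (y : R) : ℕ+ → R :=
  fun j => algebraMap ℂ R (1 / ((j : ℕ) : ℂ)) * y ^ (j : ℕ)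

theorem timeSeries_add_bracket (s : ℕ+ → R) (y : R) :
    timeSeries (s + bracket y) = timeSeries s + PowerSeries.mk fun n => y ^ (n + 1) := by
  ext n
  simp only [timeSeries, PowerSeries.coeff_mk, map_add, Pi.add_apply, mul_add]
  rw [bracket, ← mul_assoc, Nat.succPNat_coe, Nat.succ_eq_add_one]
  congr 1
  have : ((n : R) + 1) = algebraMap ℂ R ((n : ℂ) + 1) := by simp
  rw [this, ← map_mul]
  have h0 : (n : ℂ) + 1 ≠ 0 := by exact_mod_cast Nat.succ_ne_zero n
  rw [Nat.cast_add_one, mul_one_div_cancel h0, map_one, one_mul]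

/-- This is exp(∑ yⁱzⁱ/i) = 1/(1 - yz): both sides have constant term 1 and the same logarithmic
derivative. -/
theorem hSeries_add_bracket (s : ℕ+ → R) (y : R) :
    hSeries (s + bracket y) * (1 - PowerSeries.C y * PowerSeries.X) = hSeries s := by
  refine eq_of_derivative_eq_mul (a := timeSeries s) ?_ (derivative_hSeries s) ?_
  · have h1 : (1 - PowerSeries.C y * PowerSeries.X) * (PowerSeries.mk fun n => y ^ (n + 1)) =
        PowerSeries.C y := by
      ext n
      rw [sub_mul, one_mul, mul_assoc, map_sub, PowerSeries.coeff_C_mul]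
      rcases n with _ | n
      · simp
      · rw [PowerSeries.coeff_succ_X_mul]
        simp only [PowerSeries.coeff_mk, PowerSeries.coeff_C, Nat.succ_ne_zero, if_false]
        ring
    have h2 : PowerSeries.derivative R (1 - PowerSeries.C y * PowerSeries.X) =
        -PowerSeries.C y := by
      ext n
      simp [PowerSeries.coeff_C]
    rw [Derivation.leibniz, h2, derivative_hSeries, timeSeries_add_bracket]
    simp only [smul_eq_mul]
    linear_combination (hSeries (s + bracket y)) * h1
  · simp [mul_sub, coeff_zero_hSeries, ← mul_assoc]
    simpa using coeff_zero_hSeries (s + bracket y)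

/-- The only property of the h's used by the confluent determinants below. It holds at every integer
m because of the convention h_m = 0 for m < 0. -/
theorem hAt_eq_sub (s : ℕ+ → R) (y : R) (m : ℤ) :
    hAt s m = hAt (s + bracket y) m - y * hAt (s + bracket y) (m - 1) := by
  rcases lt_or_ge m 0 with hm | hm
  · rw [hAt_of_neg _ hm, hAt_of_neg _ hm, hAt_of_neg _ (by omega), mul_zero, sub_zero]
  · obtain ⟨n, rfl⟩ := Int.eq_ofNat_of_zero_le hm
    have h := congr_arg (PowerSeries.coeff n) (hSeries_add_bracket s y)
    rw [mul_sub, mul_one, map_sub, ← mul_assoc] at h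
    rcases n with _ | n
    · rw [hAt_of_neg _ (m := ((0 : ℕ) : ℤ) - 1) (by simp)]
      simpa [hSeries] using h.symm
    · rw [PowerSeries.coeff_succ_mul_X, PowerSeries.coeff_mul_C] at h
      simp only [hSeries, PowerSeries.coeff_mk] at h
      rw [← h, mul_comm y]
      simp

theorem hAt_zero_nat (n : ℕ) : hAt (0 : ℕ+ → R) n = if n = 0 then 1 else 0 := by
  have h : hSeries (0 : ℕ+ → R) = 1 := by
    refine eq_of_derivative_eq_mul (a := timeSeries 0) (derivative_hSeries _) ?_ ?_
    · have : timeSeries (0 : ℕ+ → R) = 0 := by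
        ext n
        simp [timeSeries]
      rw [this, mul_zero]
      ext n
      simp
    · rw [coeff_zero_hSeries]
      simp
  have h2 := congr_arg (PowerSeries.coeff n) h
  rwa [hSeries, PowerSeries.coeff_mk, PowerSeries.coeff_one] at h2

theorem hAt_at_zero (s : ℕ+ → R) : hAt s 0 = 1 := by
  have := coeff_zero_hSeries s
  rwa [hSeries, PowerSeries.coeff_mk] at this

theorem hAt_bracket (y : R) (n : ℕ) : hAt (bracket y) n = y ^ n := by
  induction n with
  | zero => simpa using hAt_at_zero (bracket y)
  | succ n ih =>
    have h := hAt_eq_sub 0 y ((n + 1 : ℕ) : ℤ)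
    rw [hAt_zero_nat, if_neg n.succ_ne_zero, zero_add] at h
    push_cast at h
    rw [add_sub_cancel_right, ih] at h
    push_cast
    rw [pow_succ', ← sub_eq_zero]
    exact h.symm

end CompleteSymmetric

/-! ### Confluent determinants -/

section Confluent

/-- The matrix whose first `m` rows are `G (T + br (y j)) m`, the remaining ones being
`G T (j + 1)`. -/
def mixedMatrix {S R : Type*} [Add S] {k : ℕ} (G : S → ℤ → Fin k → R) (br : R → S) (m : ℕ) (T : S) (y : ℕ → R) :
    Matrix (Fin k) (Fin k) R :=
  Matrix.of fun j => if (j : ℕ) < m then G (T + br (y j)) m else G T ((j : ℕ) + 1)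

theorem mixedMatrix_row {S R : Type*} [Add S] {k : ℕ} (G : S → ℤ → Fin k → R) (br : R → S) (m : ℕ) (T : S) (y : ℕ → R)
    (j : Fin k) : mixedMatrix G br m T y j =
      if (j : ℕ) < m then G (T + br (y j)) m else G T ((j : ℕ) + 1) := rfl

variable {S R : Type*} [AddCommMonoid S] [CommRing R] {k : ℕ}

/-- Row m is common to both matrices. Subtracting it from an earlier row i leaves (yᵢ - y_m) times a
row at the point shifted by both brackets, while each later row is a row at the shifted point minus
y_m times its predecessor. -/
theorem det_mixedMatrix_succ (G : S → ℤ → Fin k → R) (br : R → S)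
    (hG : ∀ s y i l, G s i l = G (s + br y) i l - y * G (s + br y) (i - 1) l)
    {m : ℕ} (hm : m < k) (T : S) (y : ℕ → R) :
    (mixedMatrix G br (m + 1) T y).det =
      (∏ j ∈ Finset.range m, (y j - y m)) * (mixedMatrix G br m (T + br (y m)) y).det := by
  obtain ⟨k, rfl⟩ : ∃ l, k = l + 1 := ⟨k - 1, by omega⟩
  set A := mixedMatrix G br (m + 1) T y with hA
  set B := mixedMatrix G br m (T + br (y m)) y with hB
  set A' : Matrix (Fin (k + 1)) (Fin (k + 1)) R :=
    Matrix.of fun i l => if (i : ℕ) < m then (y i - y m) * B i l else A i l with hA'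
  set B' : Matrix (Fin (k + 1)) (Fin (k + 1)) R :=
    Matrix.of fun i l => (if (i : ℕ) < m then y i - y m else 1) * B i l with hB'
  have hAlt : ∀ (i : Fin (k + 1)) l, (i : ℕ) < m →
      A i l = (y i - y m) * B i l + A ⟨m, hm⟩ l := by
    intro i l hi
    have h1 : (i : ℕ) < m + 1 := by omega
    simp only [hA, hB, mixedMatrix, Matrix.of_apply, if_pos h1, if_pos hi,
      if_pos (Nat.lt_succ_self m)]
    rw [hG (T + br (y i)) (y m), hG (T + br (y m)) (y i)]
    rw [add_right_comm T (br (y m)) (br (y i))]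
    push_cast
    rw [add_sub_cancel_right]
    ring
  have hAeq : ∀ l, A ⟨m, hm⟩ l = B ⟨m, hm⟩ l := by
    intro l
    simp [hA, hB, mixedMatrix]
  have hAgt : ∀ (i : Fin (k + 1)) (hi : m < i) l,
      A i l = B i l - y m * B ⟨i - 1, by omega⟩ l := by
    intro i hi l
    have h1 : ¬ (i : ℕ) < m + 1 := by omega
    have h2 : ¬ (i : ℕ) < m := by omega
    have h3 : ¬ (i : ℕ) - 1 < m := by omega
    simp only [hA, hB, mixedMatrix, Matrix.of_apply, if_neg h1, if_neg h2, if_neg h3]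
    rw [hG T (y m)]
    congr 4
    push_cast [show 1 ≤ (i : ℕ) by omega]
    ring
  have h1 : A.det = A'.det := by
    refine Matrix.det_eq_of_forall_row_eq_smul_add_const
      (fun i => if (i : ℕ) < m then 1 else 0) ⟨m, hm⟩ (by simp) fun i l => ?_
    simp only [hA', Matrix.of_apply, lt_irrefl, if_false]
    split_ifs with hi
    · rw [one_mul, hAlt i l hi]
    · rw [zero_mul, add_zero]
  -- The rows below m differ by multiples of their predecessors in `B'`, so the coefficient is y_m
  -- from row m on and 0 above.
  have h2 : B'.det = A'.det := by
    refine Matrix.det_eq_of_forall_row_eq_smul_add_pred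
      (fun i => if m < (i : ℕ) + 1 then y m else 0) (fun l => ?_) (fun i l => ?_)
    · simp only [hA', hB', Matrix.of_apply]
      split_ifs with hi
      · rfl
      · have h0 : (0 : Fin (k + 1)) = ⟨m, hm⟩ := by
          ext
          have hi' : ¬ 0 < m := hi
          change 0 = m
          omega
        rw [h0, hAeq, one_mul]
    · simp only [hA', hB', Matrix.of_apply, Fin.val_succ, Fin.val_castSucc]
      rcases lt_trichotomy ((i : ℕ) + 1) m with h | h | h
      · rw [if_pos h, if_pos h, if_neg (by omega)]
        ring
      · have h0 : i.succ = ⟨m, hm⟩ := by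
          ext
          simpa using h
        rw [if_neg (by omega), if_neg (by omega), if_neg (by omega), h0, hAeq]
        ring
      · rw [if_neg (by omega), if_neg (by omega), if_pos (by omega), if_neg (by omega),
          hAgt i.succ (by simpa using h)]
        have h0 : (⟨(i.succ : ℕ) - 1, by simp⟩ : Fin (k + 1)) = i.castSucc := by
          ext
          simp
        simp only [h0]
        ring
  rw [h1, ← h2, hB']
  rw [Matrix.det_mul_column]
  congr 1
  rw [Fin.prod_univ_eq_prod_range (fun i => if i < m then y i - y m else 1) (k + 1)]
  rw [← Finset.prod_subset (Finset.range_mono hm.le)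
    (fun i _ hi => if_neg (by simpa using hi))]
  exact Finset.prod_congr rfl fun i hi => if_pos (Finset.mem_range.1 hi)

/-- Each step moves one bracket into the base point, so the induction runs over all T. -/
theorem det_mixedMatrix (G : S → ℤ → Fin k → R) (br : R → S)
    (hG : ∀ s y i l, G s i l = G (s + br y) i l - y * G (s + br y) (i - 1) l)
    {m : ℕ} (hm : m ≤ k) (T : S) (y : ℕ → R) :
    (mixedMatrix G br m T y).det =
      (∏ i ∈ Finset.range m, ∏ j ∈ Finset.range i, (y j - y i)) *
        (Matrix.of fun j : Fin k =>
          G (T + ∑ i ∈ Finset.range m, br (y i)) ((j : ℕ) + 1)).det := by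
  induction m generalizing T with
  | zero => simp [mixedMatrix]
  | succ m ih =>
    rw [det_mixedMatrix_succ G br hG hm, ih (by omega), Finset.prod_range_succ,
      Finset.sum_range_succ, add_assoc, add_comm (br (y m))]
    ring

/-- Since yⱼ enters row j only, row replacement is replacement of a point, and the matrix exchange
identity applies. -/
theorem mixedMatrix_exchange (G : S → ℤ → Fin k → R) (br : R → S) {m : ℕ} (hm : m ≤ k) (T : S)
    (c d : ℕ → R) {i : ℕ} (hi : i < m) :
    (mixedMatrix G br m T d).det * (mixedMatrix G br m T c).det =
      ∑ j ∈ Finset.range m, (mixedMatrix G br m T (Function.update c j (d i))).det *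
        (mixedMatrix G br m T (Function.update d i (c j))).det := by
  have hup : ∀ (y : ℕ → R) x (j : Fin k), (j : ℕ) < m →
      mixedMatrix G br m T (Function.update y j x) =
        (mixedMatrix G br m T y).updateRow j (G (T + br x) m) := by
    intro y x j hj
    funext a
    by_cases h : a = j
    · subst h
      rw [mixedMatrix_row, if_pos hj, Matrix.updateRow_self, Function.update_self]
    · have h' : (a : ℕ) ≠ j := fun h2 => h (Fin.ext h2)
      rw [mixedMatrix_row, Matrix.updateRow_ne h, mixedMatrix_row, Function.update_of_ne h']
  have hrow : ∀ (y : ℕ → R) (j : Fin k), (j : ℕ) < m →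
      mixedMatrix G br m T y j = G (T + br (y j)) m := by
    intro y j hj
    rw [mixedMatrix_row, if_pos hj]
  rw [Matrix.det_mul_det_exchange _ _ ⟨i, hi.trans_le hm⟩]
  set f : ℕ → R := fun j => (mixedMatrix G br m T (Function.update c j (d i))).det *
        (mixedMatrix G br m T (Function.update d i (c j))).det
  have hsum : ∑ j ∈ Finset.range m, f j = ∑ j : Fin k, if (j : ℕ) < m then f j else 0 := by
    rw [Fin.sum_univ_eq_sum_range (fun j => if j < m then f j else 0) k,
      ← Finset.sum_subset (Finset.range_mono hm) (fun j _ hj => if_neg (by simpa using hj))]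
    exact Finset.sum_congr rfl fun j hj => (if_pos (Finset.mem_range.1 hj)).symm
  change _ = ∑ j ∈ Finset.range m, f j
  rw [hsum]
  refine Finset.sum_congr rfl fun j _ => ?_
  split_ifs with hj
  · simp only [f]
    rw [hup c (d i) j hj, hrow c j hj, hrow d ⟨i, hi.trans_le hm⟩ hi, mul_comm]
    rw [← hup d (c j) ⟨i, hi.trans_le hm⟩ hi]
  -- For j ≥ m the row j does not depend on the points, so copying it into row i creates two equal
  -- rows.
  · have hne : j ≠ ⟨i, hi.trans_le hm⟩ := fun h => hj (by rw [h]; exact hi)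
    rw [Matrix.det_zero_of_row_eq hne, zero_mul]
    rw [Matrix.updateRow_self, Matrix.updateRow_ne hne]
    rw [mixedMatrix_row, mixedMatrix_row, if_neg hj, if_neg hj]

end Confluent

/-! ### The Cauchy–Binet formula -/

theorem cauchyBinet {R : Type*} [CommRing R] {k n : ℕ} (Z W : Matrix (Fin n) (Fin k) R) :
    (Z.transpose * W).det =
      ∑ L : Fin k ↪o Fin n, (W.submatrix L id).det * (Z.submatrix L id).det := by
  classical
  have h1 : (Z.transpose * W).det =
      ∑ f : Fin k → Fin n, (∏ j, Z (f j) j) * (W.submatrix f id).det := by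
    have h2 : Z.transpose * W = fun j => ∑ l, Z l j • W l := by
      ext j a
      simp [Matrix.mul_apply, Finset.sum_apply]
    rw [h2]
    change Matrix.detRowAlternating.toMultilinearMap (fun j => ∑ l, Z l j • W l) = _
    rw [MultilinearMap.map_sum]
    refine Finset.sum_congr rfl fun f _ => ?_
    rw [MultilinearMap.map_smul_univ]
    rfl
  have h3 : ∀ L : Fin k ↪o Fin n, (W.submatrix L id).det * (Z.submatrix L id).det =
      ∑ σ : Equiv.Perm (Fin k), (∏ j, Z (L (σ j)) j) * (W.submatrix (L ∘ σ) id).det := by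
    intro L
    rw [Matrix.det_apply' (Z.submatrix L id), Finset.mul_sum]
    refine Finset.sum_congr rfl fun σ _ => ?_
    have h4 : W.submatrix (L ∘ σ) id = (W.submatrix L id).submatrix σ id := rfl
    rw [h4, Matrix.det_permute]
    simp only [Matrix.submatrix_apply, id]
    ring
  rw [h1, Finset.sum_congr rfl fun L _ => h3 L,
    ← Fintype.sum_prod_type' (fun (L : Fin k ↪o Fin n) (σ : Equiv.Perm (Fin k)) =>
      (∏ j, Z (L (σ j)) j) * (W.submatrix (L ∘ σ) id).det)]
  symm
  -- An injective f factors uniquely as an increasing map after a permutation, found by sorting; a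
  -- non-injective f gives a minor with two equal rows.
  refine Finset.sum_of_injOn (fun p : (Fin k ↪o Fin n) × Equiv.Perm (Fin k) => ⇑p.1 ∘ ⇑p.2)
    ?_ (fun _ _ => Finset.mem_coe.2 (Finset.mem_univ _)) ?_ (fun _ _ => rfl)
  · rintro ⟨L, σ⟩ _ ⟨L', σ'⟩ _ h
    have h : ⇑L ∘ ⇑σ = ⇑L' ∘ ⇑σ' := h
    have hL : L = L' := by
      apply OrderEmbedding.range_inj.1
      rw [← σ.surjective.range_comp L, ← σ'.surjective.range_comp L', h]
    subst hL
    have hσ : σ = σ' := Equiv.ext fun i => L.injective (congr_fun h i)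
    rw [hσ]
  · intro f _ hf
    by_cases hinj : Function.Injective f
    · refine absurd ⟨(OrderEmbedding.ofStrictMono (f ∘ Tuple.sort f)
        ((Tuple.monotone_sort f).strictMono_of_injective (hinj.comp (Tuple.sort f).injective)),
        (Tuple.sort f).symm), Finset.mem_coe.2 (Finset.mem_univ _), ?_⟩ hf
      funext i
      simp
    · rw [Function.Injective] at hinj
      push Not at hinj
      obtain ⟨a, b, hab, hne⟩ := hinj
      rw [Matrix.det_zero_of_row_eq hne, mul_zero]
      exact congr_arg (fun l => W l) hab

/-! ### Partitions in the k × k box and their Schur functions -/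

theorem rowLen_partitionOfTuple {k : ℕ} (L : Fin k → ℤ) (hL : StrictMono L) (i : Fin k) :
    (partitionOfTuple L hL).rowLen i = (L i.rev + ((i : ℤ) + 1)).toNat := by
  refine eq_of_forall_lt_iff fun j => ?_
  rw [← YoungDiagram.mem_iff_lt_rowLen, partitionOfTuple, YoungDiagram.mem_ofRowLens]
  simp

theorem colLen_partitionOfTuple_le {k : ℕ} (L : Fin k → ℤ) (hL : StrictMono L) :
    (partitionOfTuple L hL).colLen 0 ≤ k := by
  by_contra! h
  have h1 : (k, 0) ∈ partitionOfTuple L hL := YoungDiagram.mem_iff_lt_colLen.2 h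
  rw [partitionOfTuple, YoungDiagram.mem_ofRowLens] at h1
  obtain ⟨h1, _⟩ := h1
  simp at h1

theorem strictMono_orderEmb_sub {k n : ℕ} (L : Fin k ↪o Fin n) :
    StrictMono fun i => ((L i : ℕ) : ℤ) - k := by
  intro i j h
  have := L.strictMono h
  rw [Fin.lt_def] at this
  simpa using this

/-- The partitions with at most `k` parts, all of them at most `k`, labelled by the strictly
increasing `k`-tuples in `{0, …, 2k - 1}`. -/
def boxPartition {k : ℕ} (L : Fin k ↪o Fin (2 * k)) : YoungDiagram :=
  partitionOfTuple (fun i => ((L i : ℕ) : ℤ) - k) (strictMono_orderEmb_sub L)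

theorem le_orderEmb {k n : ℕ} (L : Fin k ↪o Fin n) (i : Fin k) : (i : ℕ) ≤ L i := by
  obtain ⟨i, hi⟩ := i
  induction i with
  | zero => exact Nat.zero_le _
  | succ i ih =>
    have h1 := ih (by omega)
    have h2 : L ⟨i, by omega⟩ < L ⟨i + 1, hi⟩ := L.strictMono (by simp)
    rw [Fin.lt_def] at h2
    simp only at h1 ⊢
    omega

theorem rowLen_boxPartition {k : ℕ} (L : Fin k ↪o Fin (2 * k)) (i : Fin k) :
    ((boxPartition L).rowLen i : ℤ) = (L i.rev : ℕ) - k + ((i : ℤ) + 1) := by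
  rw [boxPartition, rowLen_partitionOfTuple, Int.toNat_of_nonneg]
  have := le_orderEmb L i.rev
  rw [Fin.val_rev] at this
  have := i.2
  omega

theorem boxPartition_injective {k : ℕ} :
    Function.Injective (boxPartition : (Fin k ↪o Fin (2 * k)) → YoungDiagram) := by
  intro L L' h
  ext i
  have h1 := rowLen_boxPartition L i.rev
  have h2 := rowLen_boxPartition L' i.rev
  rw [h] at h1
  rw [Fin.rev_rev] at h1 h2
  omega

theorem exists_boxPartition_eq {k : ℕ} (μ : YoungDiagram) (hμ : μ.card ≤ k) :
    ∃ L : Fin k ↪o Fin (2 * k), boxPartition L = μ := by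
  have hrow : ∀ i, μ.rowLen i ≤ k := fun i => by
    rw [YoungDiagram.rowLen_eq_card]
    exact (Finset.card_le_card (Finset.filter_subset _ _)).trans hμ
  have hcol : μ.colLen 0 ≤ k := by
    rw [YoungDiagram.colLen_eq_card]
    exact (Finset.card_le_card (Finset.filter_subset _ _)).trans hμ
  have hlt : ∀ i : Fin k, μ.rowLen i.rev + i < 2 * k := fun i => by
    have := hrow i.rev
    have := i.2
    omega
  have hmono : StrictMono fun i : Fin k => (⟨μ.rowLen i.rev + i, hlt i⟩ : Fin (2 * k)) := by
    intro i j hij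
    rw [Fin.lt_def] at hij ⊢
    have := μ.rowLen_anti j.rev i.rev (by rw [Fin.val_rev, Fin.val_rev]; omega)
    simp only
    omega
  refine ⟨OrderEmbedding.ofStrictMono _ hmono, ?_⟩
  · set L := OrderEmbedding.ofStrictMono _ hmono with hL
    ext ⟨i, j⟩
    rw [YoungDiagram.mem_cells, YoungDiagram.mem_cells]
    by_cases hi : i < k
    · rw [YoungDiagram.mem_iff_lt_rowLen, YoungDiagram.mem_iff_lt_rowLen]
      have h1 := rowLen_boxPartition L ⟨i, hi⟩
      have h2 : ((L (Fin.rev ⟨i, hi⟩) : ℕ) : ℤ) = μ.rowLen i + (k - (i + 1) : ℕ) := by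
        simp only [hL, OrderEmbedding.coe_ofStrictMono, Fin.val_rev]
        rw [show k - (k - (i + 1) + 1) = i by omega]
        push_cast
        rfl
      rw [h2] at h1
      simp only at h1
      omega
    · have h1 : (boxPartition L).colLen 0 ≤ k := colLen_partitionOfTuple_le _ _
      have h2 := (boxPartition L).colLen_anti 0 j (Nat.zero_le _)
      have h3 := μ.colLen_anti 0 j (Nat.zero_le _)
      rw [YoungDiagram.mem_iff_lt_colLen, YoungDiagram.mem_iff_lt_colLen]
      omega

/-- Padding by an empty row adds the bottom row (0, …, 0, h₀) with h₀ = 1, which leaves the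
determinant unchanged. -/
theorem schur_eq_det {k : ℕ} (μ : YoungDiagram) (hμ : μ.colLen 0 ≤ k) :
    schur μ = Matrix.det (Matrix.of fun i j : Fin k =>
      completeHom ((μ.rowLen i : ℤ) - (i : ℤ) + (j : ℤ))) := by
  induction k, hμ using Nat.le_induction with
  | base => rfl
  | succ k hk ih =>
    rw [ih, Matrix.det_succ_row _ (Fin.last k), Fin.sum_univ_castSucc]
    have h0 : μ.rowLen k = 0 := by
      by_contra h
      have h1 : (k, 0) ∈ μ := YoungDiagram.mem_iff_lt_rowLen.2 (Nat.pos_of_ne_zero h)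
      have h2 := YoungDiagram.mem_iff_lt_colLen.1 h1
      omega
    rw [Finset.sum_eq_zero fun j _ => ?_]
    · have h1 : completeHom 0 = 1 := by
        have := hAt_at_zero (R := MvPolynomial ℕ+ ℂ) MvPolynomial.X
        rwa [hAt, MvPolynomial.aeval_X_left_apply] at this
      simp only [Matrix.of_apply, Fin.val_last, h0, Nat.cast_zero, zero_sub, neg_add_cancel, h1,
        mul_one, zero_add, Fin.succAbove_last]
      rw [← two_mul, pow_mul]
      simp only [even_two, Even.neg_pow, one_pow, one_mul]
      congr 1
    · have hneg : ((μ.rowLen (Fin.last k : ℕ) : ℤ) - ((Fin.last k : ℕ) : ℤ) +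
          ((j.castSucc : ℕ) : ℤ)) < 0 := by
        rw [Fin.val_last, h0, Fin.val_castSucc]
        have := j.2
        omega
      obtain ⟨m, hm⟩ := Int.eq_negSucc_of_lt_zero hneg
      rw [Matrix.of_apply, hm]
      simp [completeHom]

/-! ### Truncated tau functions as determinants -/

section Truncation

variable {R : Type*} [CommRing R] [Algebra ℂ R]

theorem aeval_schur_boxPartition {k : ℕ} (L : Fin k ↪o Fin (2 * k)) (s : ℕ+ → R) :
    MvPolynomial.aeval s (schur (boxPartition L)) =
      ((Equiv.Perm.sign (Fin.revPerm (n := k)) : ℤ) : R) *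
        Matrix.det (Matrix.of fun i j : Fin k =>
          hAt s (((L i : ℕ) : ℤ) - k + ((j : ℕ) + 1))) := by
  have hcol : (boxPartition L).colLen 0 ≤ k := colLen_partitionOfTuple_le _ _
  rw [schur_eq_det _ hcol, AlgHom.map_det, ← Matrix.det_permute]
  congr 1
  ext i j
  rw [AlgHom.mapMatrix_apply, Matrix.map_apply, Matrix.of_apply]
  change hAt s _ = hAt s _
  congr 1
  have := rowLen_boxPartition L i
  rw [this]
  simp only [Fin.revPerm_apply, id]
  ring

/-- The part of the tau function coming from the partitions in the `k × k` box, evaluated at the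
times `s`. -/
noncomputable def truncTau (v : YoungDiagram → ℂ) (k : ℕ) (s : ℕ+ → R) : R :=
  ∑ L : Fin k ↪o Fin (2 * k),
    algebraMap ℂ R (v (boxPartition L)) * MvPolynomial.aeval s (schur (boxPartition L))

/-- Coefficients and Schur functions are both k × k minors, of `W` and of the matrix of h's, so
Cauchy–Binet sums their products. The rows of the result are linear in the h's with constant
coefficients and inherit `hAt_eq_sub`. -/
theorem IsPlucker.truncTau_eq_det {v : YoungDiagram → ℂ} (hv : IsPlucker v) (k : ℕ) :
    ∃ (C : R) (G : (ℕ+ → R) → ℤ → Fin k → R),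
      (∀ s y i l, G s i l = G (s + bracket y) i l - y * G (s + bracket y) (i - 1) l) ∧
      ∀ s, truncTau v k s = C * Matrix.det (Matrix.of fun j : Fin k => G s ((j : ℕ) + 1)) := by
  by_cases h : ∃ c : Fin k → Fin (2 * k), pluckerValue v (fun i => ((c i : ℕ) : ℤ) - k) ≠ 0
  · obtain ⟨c, hc⟩ := h
    obtain ⟨W, hW⟩ := hv.eq_det (by omega) c hc
    refine ⟨algebraMap ℂ R (pluckerValue v (fun i => ((c i : ℕ) : ℤ) - k)) *
      ((Equiv.Perm.sign (Fin.revPerm (n := k)) : ℤ) : R),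
      fun s i a => ∑ l : Fin (2 * k), hAt s (((l : ℕ) : ℤ) - k + i) * algebraMap ℂ R (W l a),
      fun s y i a => ?_, fun s => ?_⟩
    · rw [Finset.mul_sum, ← Finset.sum_sub_distrib]
      refine Finset.sum_congr rfl fun l _ => ?_
      rw [hAt_eq_sub s y]
      ring_nf
    · have h1 := cauchyBinet (Matrix.of fun (l : Fin (2 * k)) (j : Fin k) =>
        hAt s (((l : ℕ) : ℤ) - k + ((j : ℕ) + 1))) (W.map (algebraMap ℂ R))
      have h2 : (Matrix.of fun (l : Fin (2 * k)) (j : Fin k) =>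
          hAt s (((l : ℕ) : ℤ) - k + ((j : ℕ) + 1))).transpose * W.map (algebraMap ℂ R) =
          Matrix.of fun (j a : Fin k) => ∑ l : Fin (2 * k), hAt s (((l : ℕ) : ℤ) - k + ((j : ℕ) + 1)) *
            algebraMap ℂ R (W l a) := by
        ext j a
        simp [Matrix.mul_apply]
      rw [h2] at h1
      refine Eq.trans ?_ (congr_arg (_ * ·) h1.symm)
      rw [truncTau, Finset.mul_sum]
      refine Finset.sum_congr rfl fun L _ => ?_
      have h3 : v (boxPartition L) = pluckerValue v (fun i => ((L i : ℕ) : ℤ) - k) :=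
        (pluckerValue_of_strictMono v _).symm
      rw [h3, hW, aeval_schur_boxPartition, map_mul, RingHom.map_det]
      change _ * Matrix.det ((W.submatrix L id).map (algebraMap ℂ R)) * _ = _
      rw [← Matrix.submatrix_map]
      change _ = _ * (_ * Matrix.det (Matrix.of fun i j : Fin k =>
          hAt s (((L i : ℕ) : ℤ) - k + ((j : ℕ) + 1))))
      ring
  -- If no coordinate in the window is nonzero there is no base tuple to normalize at, but the
  -- truncation is then 0.
  · push Not at h
    refine ⟨0, 0, by simp, fun s => ?_⟩
    rw [zero_mul, truncTau]
    refine Finset.sum_eq_zero fun L _ => ?_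
    have h3 : v (boxPartition L) = pluckerValue v (fun i => ((L i : ℕ) : ℤ) - k) :=
        (pluckerValue_of_strictMono v _).symm
    rw [h3, h, map_zero, zero_mul]

/-- The Vandermonde product of the first `m` points. -/
def vandermondeProd (m : ℕ) (y : ℕ → R) : R :=
  ∏ i ∈ Finset.range m, ∏ j ∈ Finset.range i, (y j - y i)

theorem IsPlucker.truncTau_exchange {v : YoungDiagram → ℂ} (hv : IsPlucker v) {k m : ℕ}
    (hm : m ≤ k) (T : ℕ+ → R) (c d : ℕ → R) {i : ℕ} (hi : i < m) (Φ : (ℕ → R) → R)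
    (hΦ : ∀ y, Φ y = vandermondeProd m y *
      truncTau v k (T + ∑ i ∈ Finset.range m, bracket (y i))) :
    Φ d * Φ c = ∑ j ∈ Finset.range m,
      Φ (Function.update c j (d i)) * Φ (Function.update d i (c j)) := by
  obtain ⟨C, G, hG, htau⟩ := hv.truncTau_eq_det (R := R) k
  have h1 : ∀ y, Φ y = C * (mixedMatrix G bracket m T y).det := by
    intro y
    rw [hΦ, htau, det_mixedMatrix G bracket hG hm, vandermondeProd]
    ring
  simp only [h1]
  have h2 := mixedMatrix_exchange G bracket hm T c d hi
  calc _ = C * C * ((mixedMatrix G bracket m T d).det * (mixedMatrix G bracket m T c).det) := by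
        ring
    _ = _ := by
      rw [h2, Finset.mul_sum]
      exact Finset.sum_congr rfl fun j _ => by ring

end Truncation

open MvPowerSeries in
-- A partition of size at most k fits in the k × k box, and larger ones contribute only terms of
-- weight above k.
theorem coeff_tau_of_weight_le (v : YoungDiagram → ℂ) {k : ℕ} (d : ℕ+ →₀ ℕ)
    (hd : Finsupp.weight (fun i : ℕ+ => (i : ℕ)) d ≤ k) :
    coeff d (tau v) =
      ∑ L : Fin k ↪o Fin (2 * k), v (boxPartition L) * (schur (boxPartition L)).coeff d := by
  classical
  change ∑ᶠ μ : YoungDiagram, v μ * (schur μ).coeff d = _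
  rw [finsum_eq_sum_of_support_subset (s := Finset.univ.image (boxPartition (k := k)))]
  · rw [Finset.sum_image boxPartition_injective.injOn]
  · intro μ hμ
    have hcard : μ.card ≤ k := by
      by_contra h
      refine hμ ?_
      simp only
      rw [(schur_isWeightedHomogeneous μ).coeff_eq_zero d (by omega), mul_zero]
    obtain ⟨L, rfl⟩ := exists_boxPartition_eq μ hcard
    simp

/-! ### Linear independence of Schur functions -/

/-- The bialternant formula is the confluent determinant with m = k and T = 0, since h_n([y]) = yⁿ.
-/
theorem vandermondeProd_mul_aeval_schur {R : Type*} [CommRing R] [Algebra ℂ R] {k : ℕ}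
    (L : Fin k ↪o Fin (2 * k)) (y : ℕ → R) :
    vandermondeProd k y * MvPolynomial.aeval (∑ i ∈ Finset.range k, bracket (y i))
        (schur (boxPartition L)) =
      ((Equiv.Perm.sign (Fin.revPerm (n := k)) : ℤ) : R) *
        Matrix.det (Matrix.of fun j a : Fin k => y j ^ (L a : ℕ)) := by
  have h := det_mixedMatrix (fun s i (a : Fin k) => hAt s (((L a : ℕ) : ℤ) - k + i))
    (bracket (R := R)) (fun s y i l => by
      rw [hAt_eq_sub s y]
      ring_nf) le_rfl 0 y
  rw [zero_add] at h
  rw [aeval_schur_boxPartition, mul_left_comm]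
  congr 1
  rw [← Matrix.det_transpose, vandermondeProd]
  refine h.symm.trans ?_
  congr 1
  funext j a
  rw [mixedMatrix_row, if_pos j.2, zero_add, sub_add_cancel, hAt_bracket]
  rfl

/-- The exponents of a monomial of the alternant, listed by variable, determine both L (sort them)
and the permutation. -/
theorem coeff_det_X_pow {k n : ℕ} (L L₀ : Fin k ↪o Fin n) :
    MvPolynomial.coeff (∑ a : Fin k, Finsupp.single (a : ℕ) (L₀ a : ℕ))
      (Matrix.det (Matrix.of fun j a : Fin k =>
        (MvPolynomial.X (j : ℕ) : MvPolynomial ℕ ℂ) ^ (L a : ℕ))) = if L = L₀ then 1 else 0 := by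
  classical
  have hval : ∀ (f : Fin k → ℕ) (b : Fin k),
      (∑ a : Fin k, Finsupp.single (a : ℕ) (f a)) (b : ℕ) = f b := by
    intro f b
    rw [Finsupp.finsetSum_apply, Finset.sum_eq_single b]
    · simp
    · intro a _ hab
      rw [Finsupp.single_apply, if_neg fun h => hab (Fin.ext h)]
    · simp
  have hterm : ∀ σ : Equiv.Perm (Fin k),
      (∏ a, (MvPolynomial.X ((σ a : Fin k) : ℕ) : MvPolynomial ℕ ℂ) ^ (L a : ℕ)) =
        MvPolynomial.monomial (∑ a : Fin k, Finsupp.single (a : ℕ) (L (σ.symm a) : ℕ)) 1 := by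
    intro σ
    rw [← Equiv.prod_comp σ.symm, MvPolynomial.monomial_sum_one]
    simp [MvPolynomial.X_pow_eq_monomial]
  have hone : ∀ σ : Equiv.Perm (Fin k), (∑ a : Fin k, Finsupp.single (a : ℕ) (L (σ.symm a) : ℕ)) =
      ∑ a : Fin k, Finsupp.single (a : ℕ) (L₀ a : ℕ) → L = L₀ ∧ σ = 1 := by
    intro σ h
    have h1 : ⇑L ∘ ⇑σ.symm = L₀ := by
      funext b
      have := DFunLike.congr_fun h (b : ℕ)
      rw [hval, hval] at this
      exact Fin.ext this
    have h2 : L = L₀ := by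
      apply OrderEmbedding.range_inj.1
      rw [← h1, σ.symm.surjective.range_comp]
    refine ⟨h2, ?_⟩
    subst h2
    have h3 : σ.symm = 1 := Equiv.ext fun b => L.injective (congr_fun h1 b)
    rw [← Equiv.symm_symm σ, h3]
    rfl
  rw [Matrix.det_apply', MvPolynomial.coeff_sum]
  simp only [Matrix.of_apply, hterm]
  rw [Finset.sum_eq_single 1]
  · split_ifs with h
    · subst h
      simp only [Equiv.Perm.sign_one, Units.val_one, Int.cast_one, one_mul]
      exact (MvPolynomial.coeff_monomial _ _ _).trans (if_pos rfl)
    · simp only [Equiv.Perm.sign_one, Units.val_one, Int.cast_one, one_mul]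
      rw [MvPolynomial.coeff_monomial, if_neg fun h' => h (hone 1 h').1]
  · intro σ _ hσ
    rw [← map_intCast (MvPolynomial.C (R := ℂ) (σ := ℕ)), MvPolynomial.coeff_C_mul,
      MvPolynomial.coeff_monomial, if_neg fun h' => hσ (hone σ h').2, mul_zero]
  · simp

theorem eq_zero_of_truncTau_eq_zero {v : YoungDiagram → ℂ} {k : ℕ}
    (h : ∀ s : ℕ+ → MvPolynomial ℕ ℂ, truncTau v k s = 0) (L₀ : Fin k ↪o Fin (2 * k)) :
    v (boxPartition L₀) = 0 := by
  classical
  have h1 := congr_arg (fun p => vandermondeProd k MvPolynomial.X * p)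
    (h (∑ i ∈ Finset.range k, bracket (MvPolynomial.X i)))
  simp only [truncTau, Finset.mul_sum, mul_zero, mul_left_comm (vandermondeProd k _),
    vandermondeProd_mul_aeval_schur] at h1
  have h2 : ((Equiv.Perm.sign (Fin.revPerm (n := k)) : ℤ) : MvPolynomial ℕ ℂ) *
      ∑ L : Fin k ↪o Fin (2 * k), MvPolynomial.C (v (boxPartition L)) *
        Matrix.det (Matrix.of fun j a : Fin k =>
          (MvPolynomial.X (j : ℕ) : MvPolynomial ℕ ℂ) ^ (L a : ℕ)) = 0 := by
    rw [← h1, Finset.mul_sum]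
    exact Finset.sum_congr rfl fun L _ => mul_left_comm _ _ _
  have hs : ((Equiv.Perm.sign (Fin.revPerm (n := k)) : ℤ) : MvPolynomial ℕ ℂ) ≠ 0 := by
    rcases Int.units_eq_one_or (Equiv.Perm.sign (Fin.revPerm (n := k))) with h | h <;> simp [h]
  have h3 := congr_arg (MvPolynomial.coeff (∑ a : Fin k, Finsupp.single (a : ℕ) (L₀ a : ℕ)))
    ((mul_eq_zero.1 h2).resolve_left hs)
  simpa [MvPolynomial.coeff_sum, MvPolynomial.coeff_C_mul, coeff_det_X_pow] using h3

theorem tau_ne_zero {v : YoungDiagram → ℂ} (hv : v ≠ 0) : tau v ≠ 0 := by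
  intro htau
  obtain ⟨μ₀, hμ₀⟩ := Function.ne_iff.1 hv
  set N := μ₀.card with hN
  -- Schur functions being homogeneous, the weight-N part of τ involves partitions of size N only;
  -- it is a finite sum to which independence applies.
  set v' : YoungDiagram → ℂ := fun μ => if μ.card = N then v μ else 0 with hv'
  have hpoly : ∑ L : Fin N ↪o Fin (2 * N),
      MvPolynomial.C (v' (boxPartition L)) * schur (boxPartition L) = 0 := by
    ext d
    rw [MvPolynomial.coeff_sum, MvPolynomial.coeff_zero]
    simp only [MvPolynomial.coeff_C_mul]
    by_cases hd : Finsupp.weight (fun i : ℕ+ => (i : ℕ)) d = N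
    · have h1 := coeff_tau_of_weight_le v d hd.le
      rw [htau, map_zero] at h1
      rw [h1]
      refine Finset.sum_congr rfl fun L _ => ?_
      by_cases hL : (boxPartition L).card = N
      · simp only [hv', if_pos hL]
      · rw [(schur_isWeightedHomogeneous _).coeff_eq_zero d (by omega), mul_zero, mul_zero]
    · refine Finset.sum_eq_zero fun L _ => ?_
      by_cases hL : (boxPartition L).card = N
      · rw [(schur_isWeightedHomogeneous _).coeff_eq_zero d (by omega), mul_zero]
      · simp only [hv', if_neg hL, zero_mul]
  obtain ⟨L₀, hL₀⟩ := exists_boxPartition_eq μ₀ le_rfl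
  have h0 := eq_zero_of_truncTau_eq_zero (v := v') (k := N) (fun s => by
    have := congr_arg (MvPolynomial.aeval s) hpoly
    simpa [truncTau] using this) L₀
  rw [hL₀] at h0
  simp only [hv', ← hN, if_true] at h0
  exact hμ₀ h0


/-! ### Evaluation of the tau function at shifted times -/

/-- The series `τ(t + ∑ᵢ nᵢ [xᵢ])`. -/
noncomputable def tauAt (v : YoungDiagram → ℂ) (n : ℤ →₀ ℤ) : SeriesXT :=
  MvPowerSeries.subst (shiftedTime n) (tau v)

theorem shiftedTime_eq_sum (n : ℤ →₀ ℤ) (j : ℕ+) : shiftedTime n j =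
    t j + n.sum fun i a => MvPowerSeries.C ((a : ℂ) / ((j : ℕ) : ℂ)) * x i ^ (j : ℕ) := rfl

theorem shiftedTime_add_α (n : ℤ →₀ ℤ) (i : ℤ) :
    shiftedTime (n + α i) = shiftedTime n + bracket (x i) := by
  funext j
  rw [Pi.add_apply, shiftedTime_eq_sum, shiftedTime_eq_sum, Finsupp.sum_add_index', α,
    Finsupp.sum_single_index, add_assoc]
  · rw [bracket, MvPowerSeries.algebraMap_apply]
    simp
  · simp
  · simp
  · intro l a b
    rw [← add_mul, ← map_add]
    push_cast
    ring_nf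

theorem shiftedTime_add_sum_α (n : ℤ →₀ ℤ) (s : Finset ℕ) (y : ℕ → ℤ) :
    shiftedTime (n + ∑ i ∈ s, α (y i)) = shiftedTime n + ∑ i ∈ s, bracket (x (y i)) := by
  induction s using Finset.induction_on with
  | empty => simp
  | insert a s ha ih =>
    rw [Finset.sum_insert ha, Finset.sum_insert ha, add_comm (α (y a)), ← add_assoc,
      shiftedTime_add_α, ih, add_assoc, add_comm (bracket (x (y a)))]

/-- Setting all xᵢ to 0 recovers τ. -/
theorem tauAt_ne_zero {v : YoungDiagram → ℂ} (hv : v ≠ 0) (n : ℤ →₀ ℤ) : tauAt v n ≠ 0 := by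
  intro h
  set b : ℤ ⊕ ℕ+ → MvPowerSeries ℕ+ ℂ := Sum.elim (fun _ => 0) MvPowerSeries.X with hb
  have hbs : MvPowerSeries.HasSubst b :=
    { const_coeff := fun s => by rcases s with i | j <;> simp [hb]
      coeff_zero := fun d => by
        refine Set.Subsingleton.finite fun s hs s' hs' => ?_
        rcases s with i | j
        · simp [hb] at hs
        rcases s' with i' | j'
        · simp [hb] at hs'
        simp only [hb, Sum.elim_inr, Set.mem_ofPred_eq, MvPowerSeries.coeff_X, ne_eq,
          ite_eq_right_iff, one_ne_zero, imp_false, not_not] at hs hs'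
        rw [Finsupp.single_left_injective one_ne_zero (hs.symm.trans hs')] }
  have h1 : (fun j => MvPowerSeries.subst b (shiftedTime n j)) = MvPowerSeries.X := by
    funext j
    rw [shiftedTime, ← MvPowerSeries.coe_substAlgHom hbs, map_add, map_sum]
    rw [Finset.sum_eq_zero, add_zero, t, MvPowerSeries.coe_substAlgHom, MvPowerSeries.subst_X hbs]
    · rfl
    · intro i _
      rw [map_mul, map_pow, x, MvPowerSeries.coe_substAlgHom, MvPowerSeries.subst_X hbs]
      simp [hb]
  have h2 := congr_arg (MvPowerSeries.subst b) h
  rw [tauAt, MvPowerSeries.subst_comp_subst_apply (hasSubst_shiftedTime n) hbs, h1,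
    ← MvPowerSeries.coe_substAlgHom hbs, map_zero, MvPowerSeries.subst_self] at h2
  exact tau_ne_zero hv h2

/-! ### Approximation by truncations -/

/-- The weight of the indeterminates for which `tⱼ` has weight `j` and `xᵢ` has weight `1`. -/
def xtWeight : ℤ ⊕ ℕ+ → ℕ := Sum.elim (fun _ => 1) fun j => j

/-- The ideal of the series all of whose terms have weight at least `k`. -/
def weightIdeal (k : ℕ) : Ideal SeriesXT where
  carrier := {f | (k : ℕ∞) ≤ f.weightedOrder xtWeight}
  add_mem' hf hg := (le_min hf hg).trans (MvPowerSeries.min_weightedOrder_le_add _)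
  zero_mem' := by simp
  smul_mem' c f hf := by
    refine le_trans ?_ (MvPowerSeries.le_weightedOrder_mul _)
    exact le_add_left hf

theorem mem_weightIdeal {k : ℕ} {f : SeriesXT} :
    f ∈ weightIdeal k ↔ (k : ℕ∞) ≤ f.weightedOrder xtWeight := Iff.rfl

theorem eq_zero_of_mem_weightIdeal {f : SeriesXT} (m : ℕ) (h : ∀ k, m ≤ k → f ∈ weightIdeal k) :
    f = 0 := by
  rw [← MvPowerSeries.weightedOrder_eq_top_iff xtWeight, ENat.eq_top_iff_forall_ge]
  intro k
  exact (Nat.cast_le.2 (le_max_right m k)).trans (mem_weightIdeal.1 (h _ (le_max_left m k)))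

theorem shiftedTime_mem_weightIdeal (n : ℤ →₀ ℤ) (j : ℕ+) :
    shiftedTime n j ∈ weightIdeal j := by
  refine Ideal.add_mem _ ?_ (Ideal.sum_mem _ fun i _ => Ideal.mul_mem_left _ _ ?_)
  · refine MvPowerSeries.nat_le_weightedOrder _ fun d hd => ?_
    rw [t, MvPowerSeries.coeff_X, if_neg]
    rintro rfl
    simp [xtWeight, Finsupp.weight_single] at hd
  · refine MvPowerSeries.nat_le_weightedOrder _ fun d hd => ?_
    rw [x, MvPowerSeries.coeff_X_pow, if_neg]
    rintro rfl
    simp [xtWeight, Finsupp.weight_single] at hd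

/-- Every term of the j-th shifted time has weight at least j, so the substitution cannot lower
weights. -/
theorem tauAt_sub_truncTau_mem (v : YoungDiagram → ℂ) (n : ℤ →₀ ℤ) (k : ℕ) :
    tauAt v n - truncTau v k (shiftedTime n) ∈ weightIdeal k := by
  set p : MvPolynomial ℕ+ ℂ := ∑ L : Fin k ↪o Fin (2 * k),
    MvPolynomial.C (v (boxPartition L)) * schur (boxPartition L) with hp
  have h1 : truncTau v k (shiftedTime n) =
      MvPowerSeries.subst (shiftedTime n) (p : MvPowerSeries ℕ+ ℂ) := by
    rw [MvPowerSeries.subst_coe, hp, map_sum, truncTau]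
    exact Finset.sum_congr rfl fun L _ => by rw [map_mul, MvPolynomial.algHom_C]
  rw [h1, tauAt, ← MvPowerSeries.subst_sub (hasSubst_shiftedTime n), mem_weightIdeal]
  refine le_trans ?_ (MvPowerSeries.le_weightedOrder_subst _ (hasSubst_shiftedTime n) _)
  refine le_iInf₂ fun d hd => ?_
  have h2 : k ≤ Finsupp.weight (fun i : ℕ+ => (i : ℕ)) d := by
    by_contra! h
    apply hd
    rw [map_sub, coeff_tau_of_weight_le v d h.le, MvPolynomial.coeff_coe, hp,
      MvPolynomial.coeff_sum]
    simp [MvPolynomial.coeff_C_mul]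
  refine (Nat.cast_le.2 h2).trans ?_
  rw [Finsupp.weight_apply, Finsupp.weight_apply, Finsupp.sum, Finsupp.sum]
  push_cast
  refine Finset.sum_le_sum fun j _ => ?_
  have h3 := mem_weightIdeal.1 (shiftedTime_mem_weightIdeal n j)
  simp only [Function.comp_apply, nsmul_eq_mul, smul_eq_mul, Nat.cast_mul]
  gcongr

theorem IsPlucker.tauAt_exchange {v : YoungDiagram → ℂ} (hv : IsPlucker v) {m : ℕ}
    (T : ℤ →₀ ℤ) (c d : ℕ → ℤ) {i : ℕ} (hi : i < m) (Φ : (ℕ → ℤ) → SeriesXT)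
    (hΦ : ∀ y, Φ y = vandermondeProd m (fun j => x (y j)) *
      tauAt v (T + ∑ i ∈ Finset.range m, α (y i))) :
    Φ d * Φ c = ∑ j ∈ Finset.range m,
      Φ (Function.update c j (d i)) * Φ (Function.update d i (c j)) := by
  rw [← sub_eq_zero]
  -- The relation is checked modulo terms of weight k for each k ≥ m; the bound leaves room for m
  -- point rows in a k × k determinant.
  refine eq_zero_of_mem_weightIdeal m fun k hk => ?_
  set Ψ : (ℕ → SeriesXT) → SeriesXT := fun y => vandermondeProd m y *
    truncTau v k (shiftedTime T + ∑ i ∈ Finset.range m, bracket (y i)) with hΨ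
  have h1 := hv.truncTau_exchange hk (shiftedTime T) (fun j => x (c j)) (fun j => x (d j)) hi Ψ
    fun _ => rfl
  have h2 : ∀ y, Ideal.Quotient.mk (weightIdeal k) (Φ y) =
      Ideal.Quotient.mk (weightIdeal k) (Ψ fun j => x (y j)) := by
    intro y
    rw [Ideal.Quotient.eq, hΦ, hΨ]
    simp only
    rw [← mul_sub, ← shiftedTime_add_sum_α]
    exact Ideal.mul_mem_left _ _ (tauAt_sub_truncTau_mem v _ k)
  have hup : ∀ (y : ℕ → ℤ) j a, (fun l => x (Function.update y j a l)) =
      Function.update (fun l => x (y l)) j (x a) := fun y j a => Function.comp_update x y j a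
  rw [← Ideal.Quotient.eq_zero_iff_mem, map_sub, map_sum, map_mul]
  simp only [map_mul, h2, hup]
  rw [← map_mul, h1, map_sum]
  simp


/-! ### The prefactor of `H` -/

/-- The indeterminate `xᵢ` in the fraction field. -/
noncomputable def xF (i : ℤ) : FieldXT := algebraMap SeriesXT FieldXT (x i)

theorem xF_sub_ne_zero {i j : ℤ} (h : i ≠ j) : xF i - xF j ≠ 0 := by
  rw [sub_ne_zero]
  intro h1
  have h2 : x i = x j := IsFractionRing.injective SeriesXT FieldXT h1
  rw [x, x] at h2
  have h3 := congr_arg (MvPowerSeries.coeff (Finsupp.single (Sum.inl i : ℤ ⊕ ℕ+) 1)) h2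
  rw [MvPowerSeries.coeff_index_single_self_X, MvPowerSeries.coeff_index_single_X, if_neg] at h3
  · exact one_ne_zero h3
  · simpa using h

/-- The bilinear version `∏_{i < j} (xᵢ - xⱼ)^{nᵢ mⱼ}` of the prefactor of `H`. -/
noncomputable def crossProd (n m : ℤ →₀ ℤ) : FieldXT :=
  n.prod fun i a => m.prod fun j b => if i < j then (xF i - xF j) ^ (a * b) else 1

theorem H_eq_crossProd_mul (v : YoungDiagram → ℂ) (n : ℤ →₀ ℤ) :
    H v n = crossProd n n * algebraMap SeriesXT FieldXT (tauAt v n) := by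
  rw [H, crossProd, tauAt]
  congr 1
  refine Finset.prod_congr rfl fun i _ => ?_
  rw [Finset.prod_filter]
  refine Finset.prod_congr rfl fun j _ => ?_
  rw [map_sub]
  rfl

theorem crossProd_ne_zero (n m : ℤ →₀ ℤ) : crossProd n m ≠ 0 := by
  refine Finset.prod_ne_zero_iff.2 fun i _ => Finset.prod_ne_zero_iff.2 fun j _ => ?_
  simp only
  split_ifs with h
  · exact zpow_ne_zero _ (xF_sub_ne_zero h.ne)
  · exact one_ne_zero

theorem crossProd_add_left (n n' m : ℤ →₀ ℤ) :
    crossProd (n + n') m = crossProd n m * crossProd n' m := by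
  refine Finsupp.prod_add_index' (fun i => ?_) fun i a b => ?_
  · simp
  · rw [← Finsupp.prod_mul]
    refine Finset.prod_congr rfl fun j _ => ?_
    simp only
    split_ifs with h
    · rw [add_mul, zpow_add₀ (xF_sub_ne_zero h.ne)]
    · rw [one_mul]

theorem crossProd_add_right (n m m' : ℤ →₀ ℤ) :
    crossProd n (m + m') = crossProd n m * crossProd n m' := by
  rw [crossProd, crossProd, crossProd, ← Finsupp.prod_mul]
  refine Finset.prod_congr rfl fun i _ => ?_
  refine Finsupp.prod_add_index' (fun j => ?_) fun j a b => ?_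
  · simp
  · split_ifs with h
    · rw [mul_add, zpow_add₀ (xF_sub_ne_zero h.ne)]
    · rw [one_mul]

theorem crossProd_sum_left {ι : Type*} (s : Finset ι) (f : ι → ℤ →₀ ℤ) (m : ℤ →₀ ℤ) :
    crossProd (∑ i ∈ s, f i) m = ∏ i ∈ s, crossProd (f i) m := by
  classical
  induction s using Finset.induction_on with
  | empty => simp [crossProd]
  | insert a s ha ih => rw [Finset.sum_insert ha, Finset.prod_insert ha, crossProd_add_left, ih]

theorem crossProd_sum_right {ι : Type*} (s : Finset ι) (n : ℤ →₀ ℤ) (f : ι → ℤ →₀ ℤ) :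
    crossProd n (∑ i ∈ s, f i) = ∏ i ∈ s, crossProd n (f i) := by
  classical
  induction s using Finset.induction_on with
  | empty => simp [crossProd]
  | insert a s ha ih => rw [Finset.sum_insert ha, Finset.prod_insert ha, crossProd_add_right, ih]

theorem crossProd_α_α (i j : ℤ) :
    crossProd (α i) (α j) = if i < j then xF i - xF j else 1 := by
  rw [crossProd, α, α, Finsupp.prod_single_index, Finsupp.prod_single_index]
  · simp
  · simp
  · simp

theorem H_ne_zero {v : YoungDiagram → ℂ} (hv : v ≠ 0) (n : ℤ →₀ ℤ) : H v n ≠ 0 := by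
  rw [H_eq_crossProd_mul]
  refine mul_ne_zero (crossProd_ne_zero _ _) fun h => tauAt_ne_zero hv n ?_
  exact IsFractionRing.injective SeriesXT FieldXT (h.trans (map_zero _).symm)

theorem prod_prod_eq_prod_prod_lt {m : ℕ} {R : Type*} [CommMonoid R] (f : Fin m → Fin m → R)
    (hf : ∀ i, f i i = 1) :
    ∏ i, ∏ j, f i j = ∏ i, ∏ j, if j < i then f i j * f j i else 1 := by
  have h1 : ∀ i j, (if j < i then f i j * f j i else 1) =
      (if j < i then f i j else 1) * (if j < i then f j i else 1) := by
    intro i j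
    split_ifs <;> simp
  simp only [h1, Finset.prod_mul_distrib]
  rw [Finset.prod_comm (f := fun i j => if j < i then f j i else 1)]
  simp only [← Finset.prod_mul_distrib]
  refine Finset.prod_congr rfl fun i _ => Finset.prod_congr rfl fun j _ => ?_
  rcases lt_trichotomy i j with h | h | h
  · simp [h, h.not_gt]
  · subst h
    simp [hf]
  · simp [h, h.not_gt]

/-! ### Antisymmetrized lattice evaluations -/

variable {m : ℕ}

/-- The sign `∏_{j < i} sgn (yᵢ - yⱼ)` of a tuple of integers (`0` if it has repetitions). -/
noncomputable def signProd (y : Fin m → ℤ) : FieldXT :=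
  ∏ i, ∏ j, if j < i then ((Int.sign (y i - y j) : ℤ) : FieldXT) else 1

/-- The product `∏_{j < i} (x_{yⱼ} - x_{yᵢ})`. -/
noncomputable def xVandermonde (y : Fin m → ℤ) : SeriesXT :=
  ∏ i, ∏ j, if j < i then x (y j) - x (y i) else 1

/-- The prefactor of H orders each difference by the size of the indices, the Vandermonde product by
their positions; the sign corrects this, and kills repeated indices, at which the prefactor alone
does not vanish. -/
theorem signProd_mul_crossProd (y : Fin m → ℤ) :
    signProd y * crossProd (∑ i, α (y i)) (∑ i, α (y i)) =
      algebraMap SeriesXT FieldXT (xVandermonde y) := by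
  rw [crossProd_sum_left]
  simp only [crossProd_sum_right]
  rw [prod_prod_eq_prod_prod_lt _ (fun i => by rw [crossProd_α_α, if_neg (lt_irrefl _)]),
    signProd, xVandermonde, map_prod, ← Finset.prod_mul_distrib]
  refine Finset.prod_congr rfl fun i _ => ?_
  rw [map_prod, ← Finset.prod_mul_distrib]
  refine Finset.prod_congr rfl fun j _ => ?_
  split_ifs
  · rw [crossProd_α_α, crossProd_α_α, map_sub]
    change _ = xF (y j) - xF (y i)
    rcases lt_trichotomy (y i) (y j) with h | h | h
    · rw [if_pos h, if_neg h.not_gt, Int.sign_eq_neg_one_of_neg (by omega)]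
      push_cast
      ring
    · rw [h]
      simp
    · rw [if_pos h, if_neg h.not_gt, Int.sign_eq_one_of_pos (by omega)]
      push_cast
      ring
  · rw [one_mul, map_one]

theorem xVandermonde_eq_det (y : Fin m → ℤ) :
    xVandermonde y = (Matrix.vandermonde fun i => -x (y i)).det := by
  rw [Matrix.det_vandermonde, xVandermonde, Finset.prod_comm]
  refine Finset.prod_congr rfl fun i _ => ?_
  rw [← Finset.prod_filter]
  refine Finset.prod_congr (by ext; simp) fun j _ => by ring

/-- The lattice evaluation of the tau function at `T + ∑ᵢ α_{yᵢ}`, made antisymmetric in `y`. -/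
noncomputable def altH (v : YoungDiagram → ℂ) (T : ℤ →₀ ℤ) (y : Fin m → ℤ) : FieldXT :=
  signProd y * H v (T + ∑ i, α (y i))

/-- The interaction of the points of `T` with `α p`. -/
noncomputable def crossFactor (T : ℤ →₀ ℤ) (p : ℤ) : FieldXT :=
  crossProd T (α p) * crossProd (α p) T

theorem crossFactor_ne_zero (T : ℤ →₀ ℤ) (p : ℤ) : crossFactor T p ≠ 0 :=
  mul_ne_zero (crossProd_ne_zero _ _) (crossProd_ne_zero _ _)

theorem altH_eq (v : YoungDiagram → ℂ) (T : ℤ →₀ ℤ) (y : Fin m → ℤ) :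
    altH v T y = crossProd T T * (∏ i, crossFactor T (y i)) *
      algebraMap SeriesXT FieldXT (xVandermonde y * tauAt v (T + ∑ i, α (y i))) := by
  rw [altH, H_eq_crossProd_mul, crossProd_add_left, crossProd_add_right, crossProd_add_right,
    map_mul, ← signProd_mul_crossProd]
  simp only [crossFactor, Finset.prod_mul_distrib]
  rw [← crossProd_sum_left, ← crossProd_sum_right]
  ring

theorem altH_comp_perm (v : YoungDiagram → ℂ) (T : ℤ →₀ ℤ) (y : Fin m → ℤ)
    (σ : Equiv.Perm (Fin m)) :
    altH v T (y ∘ σ) = ((Equiv.Perm.sign σ : ℤ) : FieldXT) * altH v T y := by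
  have h1 : xVandermonde (y ∘ σ) = ((Equiv.Perm.sign σ : ℤ) : SeriesXT) * xVandermonde y := by
    rw [xVandermonde_eq_det, xVandermonde_eq_det, ← Matrix.det_permute]
    rfl
  rw [altH_eq, altH_eq, h1]
  simp only [Function.comp_apply]
  rw [Equiv.prod_comp σ (fun i => crossFactor T (y i)), Equiv.sum_comp σ (fun i => α (y i))]
  simp only [map_mul, map_intCast]
  ring

theorem altH_of_not_injective (v : YoungDiagram → ℂ) (T : ℤ →₀ ℤ) {y : Fin m → ℤ}
    (hy : ¬ Function.Injective y) : altH v T y = 0 := by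
  have h1 : xVandermonde y = 0 := by
    rw [Function.Injective] at hy
    push Not at hy
    obtain ⟨a, b, hab, hne⟩ := hy
    rw [xVandermonde_eq_det, Matrix.det_zero_of_row_eq hne]
    funext j
    rw [Matrix.vandermonde_apply, Matrix.vandermonde_apply, hab]
  rw [altH_eq, h1, zero_mul, map_zero, mul_zero]

theorem prod_update_mul {ι X R : Type*} [Fintype ι] [DecidableEq ι] [CommMonoid R] (χ : X → R)
    (y : ι → X) (j : ι) (a : X) :
    (∏ l, χ (Function.update y j a l)) * χ (y j) = (∏ l, χ (y l)) * χ a := by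
  rw [← Finset.mul_prod_erase _ _ (Finset.mem_univ j),
    ← Finset.mul_prod_erase _ (fun l => χ (y l)) (Finset.mem_univ j), Function.update_self]
  rw [Finset.prod_congr rfl fun l hl => by
    rw [Function.update_of_ne (Finset.ne_of_mem_erase hl)]]
  rw [mul_right_comm, mul_comm (χ a), mul_right_comm]

theorem IsPlucker.altH_exchange {v : YoungDiagram → ℂ} (hv : IsPlucker v) (T : ℤ →₀ ℤ)
    (c d : Fin m → ℤ) (i : Fin m) :
    altH v T d * altH v T c = ∑ j, altH v T (Function.update c j (d i)) *
      altH v T (Function.update d i (c j)) := by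
  set Ψ : (Fin m → ℤ) → SeriesXT := fun y => xVandermonde y * tauAt v (T + ∑ i, α (y i)) with hΨ
  have hex : Ψ d * Ψ c = ∑ j, Ψ (Function.update c j (d i)) * Ψ (Function.update d i (c j)) := by
    -- Only the first m entries matter, so the padding value 0 is arbitrary.
    set ext : (Fin m → ℤ) → ℕ → ℤ := fun y l => if h : l < m then y ⟨l, h⟩ else 0 with hext
    have hval : ∀ (y : Fin m → ℤ) (l : Fin m), ext y l = y l := by
      intro y l
      simp [hext]
    have hup : ∀ (y : Fin m → ℤ) (j : Fin m) a,
        Function.update (ext y) j a = ext (Function.update y j a) := by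
      intro y j a
      funext l
      by_cases hl : l < m
      · by_cases h : l = j
        · subst h
          simp [hext]
        · have h' : (⟨l, hl⟩ : Fin m) ≠ j := fun h2 => h (congr_arg Fin.val h2)
          rw [Function.update_of_ne h]
          simp only [hext, dif_pos hl]
          rw [Function.update_of_ne h']
      · rw [Function.update_of_ne (fun h => hl (by rw [h]; exact j.2))]
        simp only [hext, dif_neg hl]
    set Φ : (ℕ → ℤ) → SeriesXT := fun y => vandermondeProd m (fun j => x (y j)) *
      tauAt v (T + ∑ i ∈ Finset.range m, α (y i)) with hΦ
    have h1 : ∀ y, Φ (ext y) = Ψ y := by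
      intro y
      simp only [hΦ, hΨ]
      rw [Finset.sum_range]
      simp only [hval]
      congr 1
      rw [vandermondeProd, xVandermonde, Finset.prod_range]
      refine Finset.prod_congr rfl fun i _ => ?_
      have h2 : ∀ j : Fin m, (if j < i then x (y j) - x (y i) else 1) =
          (fun j : ℕ => if j < (i : ℕ) then x (ext y j) - x (ext y i) else 1) j := by
        intro j
        simp only [hval, Fin.lt_def]
      rw [Finset.prod_congr rfl fun j _ => h2 j,
        Fin.prod_univ_eq_prod_range
          (fun j : ℕ => if j < (i : ℕ) then x (ext y j) - x (ext y i) else 1) m,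
        ← Finset.prod_subset (Finset.range_mono i.2.le)
          (fun j _ hj => if_neg (by simpa using hj))]
      exact Finset.prod_congr rfl fun j hj => (if_pos (Finset.mem_range.1 hj)).symm
    have h3 := hv.tauAt_exchange T (ext c) (ext d) i.2 Φ fun _ => rfl
    rw [Finset.sum_range] at h3
    simpa only [hval, hup, h1] using h3
  have hA : ∀ y, altH v T y = crossProd T T * (∏ i, crossFactor T (y i)) *
      algebraMap SeriesXT FieldXT (Ψ y) := altH_eq v T
  -- Each exchange merely swaps one entry of c with one of d, so the product of one-point factors
  -- over both tuples does not change.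
  have hχ : ∀ j, (∏ l, crossFactor T (Function.update c j (d i) l)) *
      (∏ l, crossFactor T (Function.update d i (c j) l)) =
        (∏ l, crossFactor T (d l)) * ∏ l, crossFactor T (c l) := by
    intro j
    have h1 := prod_update_mul (crossFactor T) c j (d i)
    have h2 := prod_update_mul (crossFactor T) d i (c j)
    apply mul_right_cancel₀ (mul_ne_zero (crossFactor_ne_zero T (c j))
      (crossFactor_ne_zero T (d i)))
    linear_combination (∏ l, crossFactor T (Function.update d i (c j) l)) *
      crossFactor T (d i) * h1 + (∏ l, crossFactor T (c l)) * crossFactor T (d i) * h2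
  have h4 := congr_arg (algebraMap SeriesXT FieldXT) hex
  rw [map_mul, map_sum] at h4
  simp only [map_mul] at h4
  calc altH v T d * altH v T c = crossProd T T * crossProd T T *
        ((∏ l, crossFactor T (d l)) * ∏ l, crossFactor T (c l)) *
        (algebraMap SeriesXT FieldXT (Ψ d) * algebraMap SeriesXT FieldXT (Ψ c)) := by
        rw [hA, hA]
        ring
    _ = _ := by
        rw [h4, Finset.mul_sum]
        refine Finset.sum_congr rfl fun j _ => ?_
        rw [hA, hA, ← hχ j]
        ring

theorem signProd_of_strictMono {c : Fin m → ℤ} (hc : StrictMono c) : signProd c = 1 := by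
  refine Finset.prod_eq_one fun i _ => Finset.prod_eq_one fun j _ => ?_
  split_ifs with h
  · have := hc h
    rw [Int.sign_eq_one_of_pos (by omega), Int.cast_one]
  · rfl

theorem signProd_of_strictAnti {d : Fin m → ℤ} (hd : StrictAnti d) :
    signProd d = ∏ i : Fin m, ∏ j : Fin m, if j < i then -1 else 1 := by
  refine Finset.prod_congr rfl fun i _ => Finset.prod_congr rfl fun j _ => ?_
  split_ifs with h
  · have := hd h
    rw [Int.sign_eq_neg_one_of_neg (by omega)]
    simp
  · rfl

/-- The large entry at position j is inverted exactly with the positions after it. The sign depends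
on j alone and so is a column factor in the determinant. -/
theorem signProd_update {c : Fin m → ℤ} (hc : StrictMono c) (j : Fin m) {a : ℤ}
    (ha : ∀ l, c l < a) :
    signProd (Function.update c j a) = ∏ i : Fin m, if j < i then -1 else 1 := by
  refine Finset.prod_congr rfl fun i _ => ?_
  have h1 : ∀ l : Fin m, (if l < i then
      ((Int.sign (Function.update c j a i - Function.update c j a l) : ℤ) : FieldXT) else 1) =
      if l = j then (if j < i then -1 else 1) else 1 := by
    intro l
    by_cases hlj : l = j
    · subst hlj
      rw [if_pos rfl]
      split_ifs with h
      · rw [Function.update_self, Function.update_of_ne h.ne',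
          Int.sign_eq_neg_one_of_neg (by have := ha i; omega)]
        simp
      · rfl
    · rw [if_neg hlj]
      split_ifs with h
      · rw [Function.update_of_ne hlj]
        have h2 : c l < Function.update c j a i := by
          by_cases hij : i = j
          · subst hij
            rw [Function.update_self]
            exact ha l
          · rw [Function.update_of_ne hij]
            exact hc h
        rw [Int.sign_eq_one_of_pos (by omega), Int.cast_one]
      · rfl
  rw [Finset.prod_congr rfl fun l _ => h1 l, Finset.prod_ite_eq' Finset.univ j,
    if_pos (Finset.mem_univ j)]

theorem sum_update_α (c : Fin m → ℤ) (j : Fin m) (a : ℤ) :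
    ∑ l, α (Function.update c j a l) = ∑ l, α (c l) + α a - α (c j) := by
  rw [eq_sub_iff_add_eq]
  -- The additive bookkeeping is the product identity read in the multiplicative copy of the
  -- lattice.
  exact prod_update_mul (R := Multiplicative (ℤ →₀ ℤ)) (fun p => Multiplicative.ofAdd (α p)) c j a

/-- With T = n - ∑ α_{cᵢ}, the base value of `altH` is H at n. Reversing the order of d costs one
sign per pair of positions, exactly the product of the column signs of `signProd_update`. -/
theorem IsPlucker.H_div_eq_det {v : YoungDiagram → ℂ} (hv : IsPlucker v) (hv0 : v ≠ 0)
    (n : ℤ →₀ ℤ) (c d : Fin m → ℤ) (hc : StrictMono c) (hd : StrictAnti d)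
    (hcd : ∀ i j, c i < d j) :
    H v (n + ∑ i, α (d i) - ∑ i, α (c i)) / H v n =
      Matrix.det (Matrix.of fun i j : Fin m => H v (n + α (d i) - α (c j)) / H v n) := by
  set T := n - ∑ i, α (c i) with hT
  have hc1 : altH v T c = H v n := by
    rw [altH, signProd_of_strictMono hc, one_mul, hT, sub_add_cancel]
  have h := div_eq_det_of_exchange (altH v T) c (by rw [hc1]; exact H_ne_zero hv0 n)
    (altH_comp_perm v T c)
    (fun f hf => altH_of_not_injective v T fun h => hf h.of_comp)
    (fun d i => hv.altH_exchange T c d i) d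
  have hd1 : altH v T d = (∏ j : Fin m, ∏ i : Fin m, if j < i then (-1 : FieldXT) else 1) *
      H v (n + ∑ i, α (d i) - ∑ i, α (c i)) := by
    rw [altH, signProd_of_strictAnti hd, Finset.prod_comm, hT]
    congr 2
    abel
  have hu : ∀ i j, altH v T (Function.update c j (d i)) =
      (∏ l : Fin m, if j < l then (-1 : FieldXT) else 1) * H v (n + α (d i) - α (c j)) := by
    intro i j
    rw [altH, signProd_update hc j (fun l => hcd l i), sum_update_α, hT]
    congr 2
    abel
  have hs : (∏ j : Fin m, ∏ i : Fin m, if j < i then (-1 : FieldXT) else 1) ≠ 0 := by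
    refine Finset.prod_ne_zero_iff.2 fun j _ => Finset.prod_ne_zero_iff.2 fun i _ => ?_
    split_ifs <;> simp
  simp only [hc1, hd1, hu, mul_div_assoc] at h
  have h2 := Matrix.det_mul_row (fun j : Fin m => ∏ l : Fin m, if j < l then (-1 : FieldXT) else 1)
    (Matrix.of fun i j : Fin m => H v (n + α (d i) - α (c j)) / H v n)
  exact mul_left_cancel₀ hs (h.trans h2)

/-! ### Frobenius coordinates -/

/-- Were (i, i) missing, every diagonal cell would have index below i, leaving at most i of them.
Membership also makes the truncated subtractions in `arm` and `leg` exact. -/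
theorem diag_mem_of_lt_frobeniusRank {μ : YoungDiagram} {i : ℕ} (hi : i < frobeniusRank μ) :
    (i, i) ∈ μ := by
  by_contra h
  have h1 : (μ.cells.filter fun c => c.1 = c.2) ⊆
      (Finset.range i).image fun l => ((l, l) : ℕ × ℕ) := by
    rintro ⟨a, b⟩ hab
    rw [Finset.mem_filter] at hab
    obtain ⟨hab, rfl : a = b⟩ := hab
    refine Finset.mem_image.2 ⟨a, Finset.mem_range.2 ?_, rfl⟩
    by_contra! hia
    exact h (μ.up_left_mem hia hia hab)
  have h2 := (Finset.card_le_card h1).trans Finset.card_image_le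
  rw [Finset.card_range] at h2
  exact absurd hi (not_lt.2 h2)

theorem arm_strictAnti (μ : YoungDiagram) :
    StrictAnti fun i : Fin (frobeniusRank μ) => (arm μ i : ℤ) := by
  intro i j hij
  have h1 := YoungDiagram.mem_iff_lt_rowLen.1 (diag_mem_of_lt_frobeniusRank j.2)
  have h2 := μ.rowLen_anti i j (Fin.lt_def.1 hij).le
  have h3 := Fin.lt_def.1 hij
  simp only [arm, Nat.cast_lt]
  omega

theorem leg_strictAnti (μ : YoungDiagram) :
    StrictAnti fun i : Fin (frobeniusRank μ) => (leg μ i : ℤ) := by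
  intro i j hij
  have h1 := YoungDiagram.mem_iff_lt_colLen.1 (diag_mem_of_lt_frobeniusRank j.2)
  have h2 := μ.colLen_anti i j (Fin.lt_def.1 hij).le
  have h3 := Fin.lt_def.1 hij
  simp only [leg, Nat.cast_lt]
  omega

end KPGrassmannian

theorem mainTheorem8
    (w : Projectivization ℂ (YoungDiagram → ℂ)) (hw : w ∈ KPGrassmannian.Grassmannian)
    (v : YoungDiagram → ℂ) (hv : v ≠ 0) (hvw : Projectivization.mk ℂ v hv = w)
    (n : ℤ →₀ ℤ) (μ : YoungDiagram) :
    KPGrassmannian.H v n ≠ 0 ∧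
      KPGrassmannian.HPart v n μ / KPGrassmannian.H v n =
        Matrix.det (Matrix.of fun i j : Fin (KPGrassmannian.frobeniusRank μ) =>
          KPGrassmannian.H v
            (n + KPGrassmannian.α (KPGrassmannian.arm μ i) -
              KPGrassmannian.α (-(KPGrassmannian.leg μ j : ℤ) - 1)) /
          KPGrassmannian.H v n) := by
  have hpl : KPGrassmannian.IsPlucker v := hw v hv hvw
  refine ⟨KPGrassmannian.H_ne_zero hv n, ?_⟩
  -- The indices -bᵢ - 1 increase with i because the legs decrease, and being negative they lie
  -- below all the arms.
  refine hpl.H_div_eq_det hv n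
    (fun i : Fin (KPGrassmannian.frobeniusRank μ) => -(KPGrassmannian.leg μ i : ℤ) - 1)
    (fun i : Fin (KPGrassmannian.frobeniusRank μ) => (KPGrassmannian.arm μ i : ℤ))
    (fun i j hij => ?_) (KPGrassmannian.arm_strictAnti μ) (fun i j => by omega)
  have := KPGrassmannian.leg_strictAnti μ hij
  simp only at this ⊢
  omega
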